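/- For $\beta\ge 0$ let $$h^\beta=\Big\{v=(v_k)_{k\ge1}\subset\mathbb R:\ \|v\|_{h^\beta}^2=\sum_{k\ge1}k^{2\beta}v_k^2<\infty\Big\}.$$ For $\mu\in\mathbb R$ and integers $k\ge1$ put $$A_k(\mu)=\mu(2k-1)(2k+2)-\frac{2k(2k-3)(2k-1)}{(4k+1)(4k-1)}-\frac{(2k-1)(2k+1)(2k+2)}{(4k+1)(4k+3)},$$ $$B_k=\frac{2k(2k-3)(2k-1)}{(4k-3)(4k-1)}\sqrt{\frac{4k-3}{4k+1}},\qquad C_k=\frac{(2k-1)(2k+1)(2k+2)}{(4k+3)(4k+5)}\sqrt{\frac{4k+5}{4k+1}}.$$ Let $\alpha\ge0$ and let $\mathcal A(\mu):h^{\alpha+2}\to h^\alpha$ be the bounded linear operator $$(\mathcal A(\mu)v)_1=A_1(\mu)v_1+C_1v_2,\qquad (\mathcal A(\mu)v)_k=A_k(\mu)v_k+B_kv_{k-1}+C_kv_{k+1}\quad(k\ge2).$$ Write $N$ for the nullspace and $R$ for the range of an operator. Then: a) For every $\mu\ne0$, $\mathcal A(\mu)$ is a Fredholm operator of index $0$,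 and it is symmetric, that is, $\sum_k v_k(\mathcal A(\mu)w)_k=\sum_k(\mathcal A(\mu)v)_kw_k$ (with convergent sums) for all $v,w\in h^{\alpha+2}$. b) For every $\mu>0$, $N(\mathcal A(\mu))$ is at most one-dimensional and $N(\mathcal A(\mu))\subset h^\beta$ for all $\beta\ge0$. Moreover, $N(\mathcal A(\mu))=\{0\}$ for every $\mu\le0$. There is a strictly decreasing sequence $(\mu_k)_{k\ge1}$ of positive numbers with limit $0$ such that: c) $N(\mathcal A(\mu_k))$ is one-dimensional for every $k$, and $\mathcal A(\mu)$ is invertible (with bounded inverse) for every $\mu\notin\{\mu_k:k\ge1\}\cup\{0\}$; d) $\displaystyle\mu_1\le\frac{\sqrt2}{21\sqrt5}+\frac{\sqrt5}{22\sqrt{13}}+\frac{127}{2079}\approx0.119394$ (the decimal value being correct to within $5\cdot10^{-7}$); e) for every $k$, the map $\mu\mapsto\mathcal A(\mu)$ is differentiable at $\mu_k$ in the operator norm, and the transversality condition $\mathrm D_\mu\mathcal A(\mu)|_{\mu=\mu_k}v\notin R(\mathcal A(\mu_k))$ holds for every $0\ne v\in N(\mathcal A(\mu_k))$. -/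

import Mathlib

open Topology Filter

noncomputable section

/-! ### The weighted sequence spaces

A sequence `(v_k)_{k ≥ 1}` of real numbers is written as `v : ℕ → ℝ`, where `v n` is the entry
with the index `k = n + 1`. -/

/-- The real sequences `(v_k)_{k ≥ 1}` with `∑ k ^ (2 α) * v_k ^ 2 < ∞`. -/
def hSubmodule (α : ℝ) : Submodule ℝ (ℕ → ℝ) where
  carrier := {v | Summable fun n : ℕ => ((n : ℝ) + 1) ^ (2 * α) * v n ^ 2}
  zero_mem' := by simp
  add_mem' := by
    intro a b ha hb
    refine Summable.of_nonneg_of_le (fun n => by positivity) (fun n => ?_)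
      ((ha.mul_left 2).add (hb.mul_left 2))
    have h : (0 : ℝ) ≤ ((n : ℝ) + 1) ^ (2 * α) := by positivity
    simp only [Pi.add_apply]
    nlinarith [mul_nonneg h (sq_nonneg (a n - b n))]
  smul_mem' := by
    intro c a ha
    refine (ha.mul_left (c ^ 2)).congr (fun n => ?_)
    simp only [Pi.smul_apply, smul_eq_mul]
    ring

/-- The space `h^α` as a type of its own, so that it does not inherit the product topology. -/
def WeightedSeq (α : ℝ) : Type := hSubmodule α

namespace WeightedSeq

variable {α : ℝ}

instance : AddCommGroup (WeightedSeq α) := inferInstanceAs (AddCommGroup (hSubmodule α))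

instance : Module ℝ (WeightedSeq α) := inferInstanceAs (Module ℝ (hSubmodule α))

/-- The underlying sequence of an element of `h^α`, as a linear map. -/
def toSeq (α : ℝ) : WeightedSeq α →ₗ[ℝ] (ℕ → ℝ) := (hSubmodule α).subtype

instance : CoeFun (WeightedSeq α) (fun _ => ℕ → ℝ) := ⟨fun v => toSeq α v⟩

/-- An element of `h^α` from a sequence with finite weighted norm. -/
def mk (v : ℕ → ℝ) (hv : v ∈ hSubmodule α) : WeightedSeq α := ⟨v, hv⟩

@[simp] theorem mk_apply (v : ℕ → ℝ) (hv : v ∈ hSubmodule α) (n : ℕ) : mk v hv n = v n := rfl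

theorem ext {v w : WeightedSeq α} (h : ∀ n, v n = w n) : v = w := Subtype.ext (funext h)

theorem mem (v : WeightedSeq α) : toSeq α v ∈ hSubmodule α := v.2

theorem summable (v : WeightedSeq α) :
    Summable fun n : ℕ => ((n : ℝ) + 1) ^ (2 * α) * v n ^ 2 := v.2

@[simp] theorem add_apply (v w : WeightedSeq α) (n : ℕ) : (v + w) n = v n + w n := by simp

@[simp] theorem smul_apply (c : ℝ) (v : WeightedSeq α) (n : ℕ) : (c • v) n = c * v n := by simp

theorem weight_sq (α : ℝ) (n : ℕ) (x : ℝ) :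
    (((n : ℝ) + 1) ^ α * x) ^ 2 = ((n : ℝ) + 1) ^ (2 * α) * x ^ 2 := by
  rw [mul_pow, ← Real.rpow_natCast (((n : ℝ) + 1) ^ α) 2, ← Real.rpow_mul (by positivity),
    mul_comm α]
  norm_num

/-- The weighted sequence `(k ^ α * v_k)_{k ≥ 1}` as an element of `ℓ²`. -/
def toLp (α : ℝ) : WeightedSeq α →ₗ[ℝ] lp (fun _ : ℕ => ℝ) 2 where
  toFun v := ⟨fun n => ((n : ℝ) + 1) ^ α * v n, by
    refine (memℓp_gen_iff (by norm_num)).2 ?_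
    refine v.summable.congr (fun n => ?_)
    rw [← weight_sq]
    simp [← abs_mul]⟩
  map_add' v w := by
    ext n
    exact mul_add _ _ _
  map_smul' c v := by
    ext n
    exact mul_left_comm _ _ _

@[simp] theorem toLp_apply (v : WeightedSeq α) (n : ℕ) :
    (toLp α v : ℕ → ℝ) n = ((n : ℝ) + 1) ^ α * v n := rfl

theorem toLp_injective (α : ℝ) : Function.Injective (toLp α) := by
  intro v w h
  refine ext (fun n => ?_)
  have hn := congrArg (fun u : lp (fun _ : ℕ => ℝ) 2 => (u : ℕ → ℝ) n) h
  have hpos : ((n : ℝ) + 1) ^ α ≠ 0 := (by positivity : (0 : ℝ) < ((n : ℝ) + 1) ^ α).ne'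
  exact mul_left_cancel₀ hpos hn

instance : NormedAddCommGroup (WeightedSeq α) :=
  NormedAddCommGroup.induced (WeightedSeq α) (lp (fun _ : ℕ => ℝ) 2) (toLp α) (toLp_injective α)

instance : NormedSpace ℝ (WeightedSeq α) :=
  NormedSpace.induced ℝ (WeightedSeq α) (lp (fun _ : ℕ => ℝ) 2) (toLp α)

/-- The norm of `h^α` is given by `‖v‖ ^ 2 = ∑ k ^ (2 α) * v_k ^ 2`. -/
theorem norm_sq_eq (v : WeightedSeq α) :
    ‖v‖ ^ 2 = ∑' n : ℕ, ((n : ℝ) + 1) ^ (2 * α) * v n ^ 2 := by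
  have h : ‖v‖ = ‖toLp α v‖ := rfl
  have h2 := lp.norm_rpow_eq_tsum (p := 2) (by norm_num) (toLp α v)
  rw [h]
  simp only [ENNReal.toReal_ofNat, Real.rpow_ofNat] at h2
  rw [h2]
  refine tsum_congr (fun n => ?_)
  rw [← weight_sq]
  simp [← abs_mul]

/-- Weighted composition with an index map, injective where the weight does not vanish. -/
theorem comp_bound {α β M : ℝ} {c : ℕ → ℝ} {σ : ℕ → ℕ} (hσ : Set.InjOn σ {n | c n ≠ 0})
    (hc : ∀ n, |c n| * ((n : ℝ) + 1) ^ α ≤ M * ((σ n : ℝ) + 1) ^ β) (v : WeightedSeq β) :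
    ∃ w : WeightedSeq α, (∀ n, w n = c n * v (σ n)) ∧ ‖w‖ ≤ M * ‖v‖ := by
  have hM : 0 ≤ M := by
    have h0 := hc 0
    have h1 : 0 ≤ |c 0| * (((0 : ℕ) : ℝ) + 1) ^ α := by positivity
    have h2 : 0 < ((σ 0 : ℝ) + 1) ^ β := by positivity
    by_contra h
    nlinarith
  have key : ∀ s : Finset ℕ,
      ∑ n ∈ s, ((n : ℝ) + 1) ^ (2 * α) * (c n * v (σ n)) ^ 2 ≤ M ^ 2 * ‖v‖ ^ 2 := by
    intro s
    classical
    have hterm : ∀ n : ℕ, ((n : ℝ) + 1) ^ (2 * α) * (c n * v (σ n)) ^ 2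
        ≤ M ^ 2 * (((σ n : ℝ) + 1) ^ (2 * β) * v (σ n) ^ 2) := by
      intro n
      rw [← weight_sq, ← weight_sq, ← mul_pow]
      refine sq_le_sq.2 ?_
      have e1 : |((n : ℝ) + 1) ^ α| = ((n : ℝ) + 1) ^ α := abs_of_pos (by positivity)
      have e2 : |((σ n : ℝ) + 1) ^ β| = ((σ n : ℝ) + 1) ^ β := abs_of_pos (by positivity)
      simp only [abs_mul, abs_of_nonneg hM, e1, e2]
      nlinarith [mul_le_mul_of_nonneg_right (hc n) (abs_nonneg (v (σ n)))]
    calc ∑ n ∈ s, ((n : ℝ) + 1) ^ (2 * α) * (c n * v (σ n)) ^ 2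
        = ∑ n ∈ s with c n ≠ 0, ((n : ℝ) + 1) ^ (2 * α) * (c n * v (σ n)) ^ 2 := by
          rw [Finset.sum_filter]
          refine Finset.sum_congr rfl (fun n _ => ?_)
          split_ifs with h
          · rfl
          · simp [not_not.1 h]
      _ ≤ ∑ n ∈ s with c n ≠ 0, M ^ 2 * (((σ n : ℝ) + 1) ^ (2 * β) * v (σ n) ^ 2) :=
          Finset.sum_le_sum (fun n _ => hterm n)
      _ = ∑ m ∈ (s.filter (fun n => c n ≠ 0)).image σ,
            M ^ 2 * (((m : ℝ) + 1) ^ (2 * β) * v m ^ 2) := by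
          rw [Finset.sum_image]
          intro a ha b hb hab
          exact hσ (by simpa using (Finset.mem_filter.1 ha).2)
            (by simpa using (Finset.mem_filter.1 hb).2) hab
      _ ≤ M ^ 2 * ‖v‖ ^ 2 := by
          rw [← Finset.mul_sum, norm_sq_eq]
          exact mul_le_mul_of_nonneg_left
            (v.summable.sum_le_tsum _ (fun n _ => by positivity)) (by positivity)
  have hmem : (fun n => c n * v (σ n)) ∈ hSubmodule α :=
    summable_of_sum_le (fun n => by positivity) key
  refine ⟨mk _ hmem, fun n => rfl, ?_⟩
  refine le_of_sq_le_sq ?_ (by positivity)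
  rw [norm_sq_eq, mul_pow]
  exact (mk _ hmem).summable.tsum_le_of_sum_le key

end WeightedSeq

/-! ### The operator -/

/-- The diagonal coefficients `A_k(μ)`. -/
def coeffA (μ : ℝ) (k : ℕ) : ℝ :=
  μ * (2 * k - 1) * (2 * k + 2)
    - 2 * k * (2 * k - 3) * (2 * k - 1) / ((4 * k + 1) * (4 * k - 1))
    - (2 * k - 1) * (2 * k + 1) * (2 * k + 2) / ((4 * k + 1) * (4 * k + 3))

/-- The coefficients `B_k` below the diagonal. -/
def coeffB (k : ℕ) : ℝ :=
  2 * k * (2 * k - 3) * (2 * k - 1) / ((4 * k - 3) * (4 * k - 1))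
    * Real.sqrt ((4 * k - 3) / (4 * k + 1))

/-- The coefficients `C_k` above the diagonal. -/
def coeffC (k : ℕ) : ℝ :=
  (2 * k - 1) * (2 * k + 1) * (2 * k + 2) / ((4 * k + 3) * (4 * k + 5))
    * Real.sqrt ((4 * k + 5) / (4 * k + 1))

/-- The action of `𝒜(μ)` on sequences: its entry with index `k` is
`A_k(μ) v_k + B_k v_{k-1} + C_k v_{k+1}` for `k ≥ 2` and `A_1(μ) v_1 + C_1 v_2` for `k = 1`. -/
def seqOp (μ : ℝ) (v : ℕ → ℝ) : ℕ → ℝ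
  | 0 => coeffA μ 1 * v 0 + coeffC 1 * v 1
  | n + 1 => coeffA μ (n + 2) * v (n + 1) + coeffB (n + 2) * v n + coeffC (n + 2) * v (n + 2)

theorem seqOp_add (μ : ℝ) (v w : ℕ → ℝ) : seqOp μ (v + w) = seqOp μ v + seqOp μ w := by
  funext n
  cases n <;> simp only [seqOp, Pi.add_apply] <;> ring

theorem seqOp_smul (μ c : ℝ) (v : ℕ → ℝ) : seqOp μ (c • v) = c • seqOp μ v := by
  funext n
  cases n <;> simp only [seqOp, Pi.smul_apply, smul_eq_mul] <;> ring

theorem abs_coeffA_le (μ : ℝ) (n : ℕ) :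
    |coeffA μ (n + 1)| ≤ (6 * |μ| + 32) * ((n : ℝ) + 1) ^ 2 := by
  have hn : (0 : ℝ) ≤ n := Nat.cast_nonneg n
  have h1 : |μ * (2 * ((n : ℝ) + 1) - 1) * (2 * ((n : ℝ) + 1) + 2)|
      ≤ 6 * |μ| * ((n : ℝ) + 1) ^ 2 := by
    rw [mul_assoc, abs_mul, abs_of_nonneg
      (by nlinarith : 0 ≤ (2 * ((n : ℝ) + 1) - 1) * (2 * ((n : ℝ) + 1) + 2))]
    nlinarith [mul_le_mul_of_nonneg_left (by nlinarith :
      (2 * ((n : ℝ) + 1) - 1) * (2 * ((n : ℝ) + 1) + 2) ≤ 6 * ((n : ℝ) + 1) ^ 2) (abs_nonneg μ)]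
  have h2 : |2 * ((n : ℝ) + 1) * (2 * ((n : ℝ) + 1) - 3) * (2 * ((n : ℝ) + 1) - 1)
      / ((4 * ((n : ℝ) + 1) + 1) * (4 * ((n : ℝ) + 1) - 1))| ≤ 8 * ((n : ℝ) + 1) ^ 2 := by
    have hd : 0 < (4 * ((n : ℝ) + 1) + 1) * (4 * ((n : ℝ) + 1) - 1) := by nlinarith
    rw [abs_div, abs_of_pos hd, div_le_iff₀ hd, abs_le]
    constructor <;> ring_nf <;> nlinarith [pow_nonneg hn 2, pow_nonneg hn 3, pow_nonneg hn 4]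
  have h3 : |(2 * ((n : ℝ) + 1) - 1) * (2 * ((n : ℝ) + 1) + 1) * (2 * ((n : ℝ) + 1) + 2)
      / ((4 * ((n : ℝ) + 1) + 1) * (4 * ((n : ℝ) + 1) + 3))| ≤ 8 * ((n : ℝ) + 1) ^ 2 := by
    have hd : 0 < (4 * ((n : ℝ) + 1) + 1) * (4 * ((n : ℝ) + 1) + 3) := by nlinarith
    rw [abs_div, abs_of_pos hd, div_le_iff₀ hd, abs_le]
    constructor <;> ring_nf <;> nlinarith [pow_nonneg hn 2, pow_nonneg hn 3, pow_nonneg hn 4]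
  unfold coeffA
  push_cast
  refine (abs_sub _ _).trans ?_
  refine (add_le_add (abs_sub _ _) le_rfl).trans ?_
  nlinarith [sq_nonneg ((n : ℝ) + 1)]

theorem abs_coeffC_le (n : ℕ) : |coeffC (n + 1)| ≤ 16 * ((n : ℝ) + 1) ^ 2 := by
  have hn : (0 : ℝ) ≤ n := Nat.cast_nonneg n
  have h1 : |(2 * ((n : ℝ) + 1) - 1) * (2 * ((n : ℝ) + 1) + 1) * (2 * ((n : ℝ) + 1) + 2)
      / ((4 * ((n : ℝ) + 1) + 3) * (4 * ((n : ℝ) + 1) + 5))| ≤ 8 * ((n : ℝ) + 1) ^ 2 := by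
    have hd : 0 < (4 * ((n : ℝ) + 1) + 3) * (4 * ((n : ℝ) + 1) + 5) := by nlinarith
    rw [abs_div, abs_of_pos hd, div_le_iff₀ hd, abs_le]
    constructor <;> ring_nf <;> nlinarith [pow_nonneg hn 2, pow_nonneg hn 3, pow_nonneg hn 4]
  have h2 : |Real.sqrt ((4 * ((n : ℝ) + 1) + 5) / (4 * ((n : ℝ) + 1) + 1))| ≤ 2 := by
    rw [abs_of_nonneg (Real.sqrt_nonneg _), Real.sqrt_le_left (by norm_num),
      div_le_iff₀ (by nlinarith)]
    nlinarith
  unfold coeffC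
  push_cast
  rw [abs_mul]
  nlinarith [mul_le_mul h1 h2 (abs_nonneg _) (by positivity)]

theorem abs_coeffB_le (n : ℕ) : |coeffB (n + 2)| ≤ 16 * ((n : ℝ) + 1) ^ 2 := by
  have hn : (0 : ℝ) ≤ n := Nat.cast_nonneg n
  have h1 : |2 * ((n : ℝ) + 2) * (2 * ((n : ℝ) + 2) - 3) * (2 * ((n : ℝ) + 2) - 1)
      / ((4 * ((n : ℝ) + 2) - 3) * (4 * ((n : ℝ) + 2) - 1))| ≤ 16 * ((n : ℝ) + 1) ^ 2 := by
    have hd : 0 < (4 * ((n : ℝ) + 2) - 3) * (4 * ((n : ℝ) + 2) - 1) := by nlinarith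
    rw [abs_div, abs_of_pos hd, div_le_iff₀ hd, abs_le]
    constructor <;> ring_nf <;> nlinarith [pow_nonneg hn 2, pow_nonneg hn 3, pow_nonneg hn 4]
  have h2 : |Real.sqrt ((4 * ((n : ℝ) + 2) - 3) / (4 * ((n : ℝ) + 2) + 1))| ≤ 1 := by
    rw [abs_of_nonneg (Real.sqrt_nonneg _), Real.sqrt_le_left (by norm_num),
      div_le_iff₀ (by nlinarith)]
    nlinarith
  unfold coeffB
  push_cast
  rw [abs_mul]
  nlinarith [mul_le_mul h1 h2 (abs_nonneg _) (by positivity)]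

theorem rpow_le_two_mul (α : ℝ) {x y : ℝ} (hx : 0 < x) (hxy : x ≤ 2 * y) (hyx : y ≤ 2 * x) :
    x ^ α ≤ 2 ^ |α| * y ^ α := by
  have hy : 0 < y := by linarith
  rcases le_total 0 α with h | h
  · rw [abs_of_nonneg h, ← Real.mul_rpow (by norm_num) hy.le]
    exact Real.rpow_le_rpow hx.le hxy h
  · have h2 : (2 * x) ^ α ≤ y ^ α := Real.rpow_le_rpow_of_nonpos hy hyx h
    rw [Real.mul_rpow (by norm_num) hx.le] at h2
    have h3 : (2 : ℝ) ^ |α| * 2 ^ α = 1 := by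
      rw [abs_of_nonpos h, ← Real.rpow_add (by norm_num)]
      simp
    calc x ^ α = 2 ^ |α| * (2 ^ α * x ^ α) := by rw [← mul_assoc, h3, one_mul]
      _ ≤ 2 ^ |α| * y ^ α := mul_le_mul_of_nonneg_left h2 (by positivity)

theorem seqOp_bound (α μ : ℝ) : ∃ M : ℝ, ∀ v : WeightedSeq (α + 2),
    ∃ w : WeightedSeq α, (∀ n, w n = seqOp μ v n) ∧ ‖w‖ ≤ M * ‖v‖ := by
  have hw : ∀ n : ℕ, ((n : ℝ) + 1) ^ (α + 2) = ((n : ℝ) + 1) ^ 2 * ((n : ℝ) + 1) ^ α := by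
    intro n
    rw [Real.rpow_add (by positivity), mul_comm]
    norm_num
  refine ⟨(6 * |μ| + 32) + 16 * 2 ^ |α| + 16 * 2 ^ |α|, fun v => ?_⟩
  obtain ⟨w1, h1, n1⟩ := WeightedSeq.comp_bound (α := α) (M := 6 * |μ| + 32)
    (c := fun n => coeffA μ (n + 1)) (σ := id) Function.injective_id.injOn (fun n => by
      rw [id, hw, ← mul_assoc]
      exact mul_le_mul_of_nonneg_right (abs_coeffA_le μ n) (by positivity)) v
  obtain ⟨w2, h2, n2⟩ := WeightedSeq.comp_bound (α := α) (M := 16 * 2 ^ |α|)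
    (c := fun n => coeffC (n + 1)) (σ := fun n => n + 1) (add_left_injective 1).injOn (fun n => by
      have hn : (0 : ℝ) ≤ n := Nat.cast_nonneg n
      have ha := rpow_le_two_mul α (x := (n : ℝ) + 1) (y := ((n + 1 : ℕ) : ℝ) + 1)
        (by positivity) (by push_cast; linarith) (by push_cast; linarith)
      have hb : |coeffC (n + 1)| ≤ 16 * (((n + 1 : ℕ) : ℝ) + 1) ^ 2 := by
        refine (abs_coeffC_le n).trans ?_
        push_cast
        nlinarith
      rw [hw]
      calc _ ≤ _ := mul_le_mul hb ha (by positivity) (by positivity)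
        _ = _ := by ring) v
  obtain ⟨w3, h3, n3⟩ := WeightedSeq.comp_bound (α := α) (M := 16 * 2 ^ |α|)
    (c := fun n => if n = 0 then 0 else coeffB (n + 1)) (σ := fun n => n - 1)
    (by
      intro a ha b hb hab
      simp only [Set.mem_ofPred_eq, ne_eq, ite_eq_left_iff, not_forall] at ha hb
      obtain ⟨ha, -⟩ := ha
      obtain ⟨hb, -⟩ := hb
      simp only at hab
      omega)
    (fun n => by
      cases n with
      | zero => simpa using (by positivity : (0 : ℝ) ≤ 2 ^ |α|)
      | succ n =>
        have hn : (0 : ℝ) ≤ n := Nat.cast_nonneg n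
        have ha := rpow_le_two_mul α (x := ((n + 1 : ℕ) : ℝ) + 1) (y := (n : ℝ) + 1)
          (by positivity) (by push_cast; linarith) (by push_cast; linarith)
        have hb := abs_coeffB_le n
        simp only [Nat.succ_ne_zero, if_false, Nat.add_sub_cancel]
        rw [hw]
        calc _ ≤ _ := mul_le_mul hb ha (by positivity) (by positivity)
          _ = _ := by ring) v
  refine ⟨w1 + w2 + w3, fun n => ?_, ?_⟩
  · rw [WeightedSeq.add_apply, WeightedSeq.add_apply, h1, h2, h3]
    cases n with
    | zero => simp [seqOp]
    | succ n =>
      simp [seqOp]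
      ring
  · calc ‖w1 + w2 + w3‖ ≤ ‖w1‖ + ‖w2‖ + ‖w3‖ := norm_add₃_le
      _ ≤ _ := by linarith

theorem seqOp_mem (α μ : ℝ) (v : WeightedSeq (α + 2)) : seqOp μ v ∈ hSubmodule α := by
  obtain ⟨M, hM⟩ := seqOp_bound α μ
  obtain ⟨w, hw, -⟩ := hM v
  have h : WeightedSeq.toSeq α w = seqOp μ v := funext hw
  exact h ▸ w.mem

/-- The bounded operator `𝒜(μ) : h^{α+2} → h^α`. -/
def opA (α μ : ℝ) : WeightedSeq (α + 2) →L[ℝ] WeightedSeq α :=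
  LinearMap.mkContinuousOfExistsBound
    { toFun := fun v => WeightedSeq.mk (seqOp μ v) (seqOp_mem α μ v)
      map_add' := fun v w => WeightedSeq.ext fun n => by
        simp only [WeightedSeq.mk_apply, WeightedSeq.add_apply, map_add, seqOp_add, Pi.add_apply]
      map_smul' := fun c v => WeightedSeq.ext fun n => by
        simp only [WeightedSeq.mk_apply, WeightedSeq.smul_apply, map_smul, seqOp_smul, Pi.smul_apply,
          smul_eq_mul, RingHom.id_apply] }
    (by
      obtain ⟨M, hM⟩ := seqOp_bound α μ
      refine ⟨M, fun v => ?_⟩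
      obtain ⟨w, hw, hn⟩ := hM v
      have h : WeightedSeq.mk (seqOp μ v) (seqOp_mem α μ v) = w :=
        WeightedSeq.ext fun n => (hw n).symm
      exact (congrArg norm h).trans_le hn)

@[simp] theorem opA_apply (α μ : ℝ) (v : WeightedSeq (α + 2)) (n : ℕ) :
    opA α μ v n = seqOp μ v n := rfl

/-- Symmetry of an operator `h^{α+2} → h^α` for the scalar product of `ℓ²`. -/
def IsEllTwoSymmetric {α : ℝ} (T : WeightedSeq (α + 2) →L[ℝ] WeightedSeq α) : Prop :=
  ∀ v w : WeightedSeq (α + 2),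
    (Summable fun n : ℕ => v n * T w n) ∧ (Summable fun n : ℕ => T v n * w n) ∧
      ∑' n : ℕ, v n * T w n = ∑' n : ℕ, T v n * w n

/-- A Fredholm operator whose kernel and cokernel have the same dimension. -/
def IsFredholmOfIndexZero {E F : Type*} [NormedAddCommGroup E] [NormedSpace ℝ E]
    [NormedAddCommGroup F] [NormedSpace ℝ F] (T : E →L[ℝ] F) : Prop :=
  T.IsFredholm ∧
    (Module.finrank ℝ T.ker : ℤ) - (Module.finrank ℝ (F ⧸ T.range) : ℤ) = 0

end

/-! Write 𝒜(μ) = μD − T, where D is the positive diagonal operator with entries `diagWeight`, of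
order k², and T = −𝒜(0) is tridiagonal with entries of order k. Then D : h^{α+2} → h^α is an
isomorphism and T is compact, so for μ ≠ 0 the Fredholm alternative (`isInvertible_opA_add`) makes
𝒜(μ) invertible once it is injective. Symmetry is B_{k+1} = C_k together with the decay of the
boundary term in summation by parts. Since C_k ≠ 0, a null vector is determined by its first entry,
so nullspaces are at most lines. When there is one, adding x ↦ x_1 e_1 restores invertibility, which
gives index 0. A null vector satisfies v = (μD)⁻¹Tv, and the right side smooths, so v lies in every
h^β.

For μ ≤ 0 put v_k = √(4k+1) u_k. The equation becomes a conservation law for the fluxes `bond n * (u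
(n + 1) - u n)`, with a boundary term 2/3 u_1 of the unfavourable sign. If u_1 > 0 the fluxes stay
above −2/3 u_1, and the reciprocals of the bonds sum to at most 1, so u never falls below u_1/3 and
v cannot decay (`third_le_of_seqOp_eq_zero`).

For the spectrum, w = D^{1/2}v turns 𝒜(μ)v = 0 into Kw = μw, where K = D^{-1/2}TD^{-1/2} is compact
and symmetric on ℓ² (`exists_symSeq_operator`). By the previous paragraph all eigenvalues of K are
positive, so the spectral theorem yields infinitely many, accumulating only at 0. The Gershgorin
row-sum bound for K estimates the largest one. Finally, the derivative of 𝒜 is D. If Dv = 𝒜(μ)w with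
v in the nullspace, symmetry gives ⟨v, Dv⟩ = 0, hence v = 0. -/

namespace WeightedSeq

/-! ### Completeness of h^α and compact weighted shifts -/

theorem toLp_surjective (α : ℝ) : Function.Surjective (toLp α) := by
  intro u
  have hmem : (fun n : ℕ => (((n : ℝ) + 1) ^ α)⁻¹ * u n) ∈ hSubmodule α := by
    have hu : Summable fun n : ℕ => u n ^ 2 := by
      have := (memℓp_gen_iff (p := 2) (by norm_num)).1 (lp.memℓp u)
      simpa using this
    refine hu.congr fun n => ?_
    have hpos : ((n : ℝ) + 1) ^ α ≠ 0 := (by positivity : (0 : ℝ) < ((n : ℝ) + 1) ^ α).ne'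
    rw [← weight_sq, mul_inv_cancel_left₀ hpos]
  refine ⟨mk _ hmem, ?_⟩
  ext n
  have hpos : ((n : ℝ) + 1) ^ α ≠ 0 := (by positivity : (0 : ℝ) < ((n : ℝ) + 1) ^ α).ne'
  simp [mul_inv_cancel_left₀ hpos]

/-- The isometric identification of `h^α` with `ℓ²`. -/
noncomputable def toLpEquiv (α : ℝ) : WeightedSeq α ≃ₗᵢ[ℝ] lp (fun _ : ℕ => ℝ) 2 :=
  LinearIsometryEquiv.ofSurjective ⟨toLp α, fun _ => rfl⟩ (toLp_surjective α)

theorem toLpEquiv_apply (α : ℝ) (v : WeightedSeq α) (n : ℕ) :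
    (toLpEquiv α v : ℕ → ℝ) n = ((n : ℝ) + 1) ^ α * v n := rfl

instance (α : ℝ) : CompleteSpace (WeightedSeq α) :=
  (toLpEquiv α).toIsometryEquiv.completeSpace

theorem norm_apply_le {α : ℝ} (v : WeightedSeq α) (n : ℕ) :
    ‖v n‖ ≤ (((n : ℝ) + 1) ^ α)⁻¹ * ‖v‖ := by
  have hpos : 0 < ((n : ℝ) + 1) ^ α := by positivity
  have h : ‖(toLp α v : ℕ → ℝ) n‖ ≤ ‖toLp α v‖ := lp.norm_apply_le_norm (by norm_num) _ n
  rw [toLp_apply, norm_mul, Real.norm_of_nonneg hpos.le] at h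
  rw [inv_mul_eq_div, le_div_iff₀ hpos, mul_comm]
  exact h

/-- The coordinate functionals on `h^α`. -/
noncomputable def evalCLM (α : ℝ) (n : ℕ) : WeightedSeq α →L[ℝ] ℝ :=
  LinearMap.mkContinuous
    { toFun := fun v => v n
      map_add' := fun v w => add_apply v w n
      map_smul' := fun c v => smul_apply c v n } _ (fun v => norm_apply_le v n)

@[simp] theorem evalCLM_apply {α : ℝ} (n : ℕ) (v : WeightedSeq α) : evalCLM α n v = v n := rfl

/-- The unit sequences in `h^α`. -/
noncomputable def unitSeq (α : ℝ) (i : ℕ) : WeightedSeq α :=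
  mk (Pi.single i 1) (by
    refine summable_of_ne_finset_zero (s := {i}) fun n hn => ?_
    have : n ≠ i := by simpa using hn
    simp [this])

theorem unitSeq_apply (α : ℝ) (i n : ℕ) : unitSeq α i n = if n = i then 1 else 0 := by
  exact (mk_apply _ _ n).trans (Pi.single_apply i (1 : ℝ) n)

theorem sub_apply {α : ℝ} (v w : WeightedSeq α) (n : ℕ) : (v - w) n = v n - w n := by simp

theorem zero_apply {α : ℝ} (n : ℕ) : (0 : WeightedSeq α) n = 0 := by simp

theorem exists_clm_comp {α β M : ℝ} {c : ℕ → ℝ} {σ : ℕ → ℕ} (hσ : Set.InjOn σ {n | c n ≠ 0})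
    (hc : ∀ n, |c n| * ((n : ℝ) + 1) ^ α ≤ M * ((σ n : ℝ) + 1) ^ β) :
    ∃ L : WeightedSeq β →L[ℝ] WeightedSeq α, (∀ v n, L v n = c n * v (σ n)) ∧ ‖L‖ ≤ M := by
  have hM : 0 ≤ M := by
    have h1 : 0 ≤ |c 0| * (((0 : ℕ) : ℝ) + 1) ^ α := by positivity
    exact nonneg_of_mul_nonneg_left (h1.trans (hc 0)) (by positivity)
  choose w hw hn using fun v => comp_bound hσ hc v
  refine ⟨LinearMap.mkContinuous
    { toFun := w
      map_add' := fun v v' => ext fun n => by simp only [hw, add_apply, mul_add]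
      map_smul' := fun r v => ext fun n => by
        simp only [hw, smul_apply, RingHom.id_apply]; ring } M hn, hw, ?_⟩
  exact LinearMap.mkContinuous_norm_le _ hM _

/-- A weighted composition whose coefficients are small compared with the weights is compact. -/
theorem exists_compact_comp {α β : ℝ} {c ε : ℕ → ℝ} {σ : ℕ → ℕ}
    (hσ : Set.InjOn σ {n | c n ≠ 0}) (hε : Tendsto ε atTop (𝓝 0))
    (hc : ∀ n, |c n| * ((n : ℝ) + 1) ^ α ≤ ε n * ((σ n : ℝ) + 1) ^ β) :
    ∃ L : WeightedSeq β →L[ℝ] WeightedSeq α, (∀ v n, L v n = c n * v (σ n)) ∧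
      IsCompactOperator L := by
  obtain ⟨M, hM⟩ := hε.bddAbove_range
  have hc' : ∀ n, |c n| * ((n : ℝ) + 1) ^ α ≤ M * ((σ n : ℝ) + 1) ^ β := fun n =>
    (hc n).trans (mul_le_mul_of_nonneg_right (hM ⟨n, rfl⟩) (by positivity))
  obtain ⟨L, hL, -⟩ := exists_clm_comp hσ hc'
  refine ⟨L, hL, ?_⟩
  -- Finite-rank truncations. The remainder after m coordinates is again a weighted composition,
  -- whose norm is controlled by the tail of ε.
  let F : ℕ → WeightedSeq β →L[ℝ] WeightedSeq α := fun N =>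
    ∑ i ∈ Finset.range N, (c i • evalCLM β (σ i)).smulRight (unitSeq α i)
  have hF : ∀ N v n, F N v n = if n < N then c n * v (σ n) else 0 := by
    intro N v n
    rw [← evalCLM_apply]
    simp only [F, _root_.sum_apply, map_sum, ContinuousLinearMap.smulRight_apply,
      map_smul, evalCLM_apply, unitSeq_apply, _root_.smul_apply, smul_eq_mul]
    simp
  have hlim : Tendsto F atTop (𝓝 L) := by
    rw [Metric.tendsto_atTop]
    intro δ hδ
    obtain ⟨N, hN⟩ := eventually_atTop.1 (hε.eventually_le_const (half_pos hδ))
    refine ⟨N, fun m hm => ?_⟩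
    have hb : ∀ n, |if n < m then 0 else c n| * ((n : ℝ) + 1) ^ α
        ≤ δ / 2 * ((σ n : ℝ) + 1) ^ β := by
      intro n
      split_ifs with h
      · rw [abs_zero, zero_mul]; positivity
      · exact (hc n).trans
          (mul_le_mul_of_nonneg_right (hN n (hm.trans (not_lt.1 h))) (by positivity))
    obtain ⟨R, hR, hRn⟩ := exists_clm_comp (σ := σ) (hσ.mono fun n hn => by
      simp only [Set.mem_ofPred_eq, ne_eq, ite_eq_left_iff, not_forall] at hn ⊢
      exact hn.2) hb
    have : L - F m = R := by
      ext1 v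
      refine ext fun n => ?_
      rw [_root_.sub_apply, sub_apply, hL, hF, hR]
      split_ifs <;> ring
    rw [dist_comm, dist_eq_norm, this]
    linarith
  refine isCompactOperator_of_tendsto hlim (Eventually.of_forall fun N => ?_)
  have : F N ∈ compactOperator (RingHom.id ℝ) (WeightedSeq β) (WeightedSeq α) :=
    Submodule.sum_mem _ fun i _ =>
      (isCompactOperator_of_locallyCompactSpace_dom (c i • evalCLM β (σ i))).clm_comp
        (ContinuousLinearMap.toSpanSingleton ℝ (unitSeq α i))
  exact this

end WeightedSeq

/-! ### Tridiagonal operators: compactness and summation by parts -/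

/-- The action of a tridiagonal matrix on sequences. -/
def triSeq (a b c : ℕ → ℝ) (v : ℕ → ℝ) : ℕ → ℝ
  | 0 => a 0 * v 0 + c 0 * v 1
  | n + 1 => a (n + 1) * v (n + 1) + b (n + 1) * v n + c (n + 1) * v (n + 2)

/-- Entries of order n^s cost s derivatives, and the strict inequality leaves a decaying factor. The
operator is the sum of a diagonal and two shifted weighted compositions, each compact for that
reason. -/
theorem exists_compact_triSeq {α β s M : ℝ} {a b c : ℕ → ℝ}
    (ha : ∀ n : ℕ, |a n| ≤ M * ((n : ℝ) + 1) ^ s) (hb : ∀ n : ℕ, |b n| ≤ M * ((n : ℝ) + 1) ^ s)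
    (hc : ∀ n : ℕ, |c n| ≤ M * ((n : ℝ) + 1) ^ s) (hs : s + α < β) :
    ∃ L : WeightedSeq β →L[ℝ] WeightedSeq α, (∀ v n, L v n = triSeq a b c v n) ∧
      IsCompactOperator L := by
  -- The factor 2 ^ |β| pays for moving the weight from index n to a neighbouring index, as n + 1
  -- changes by a factor of at most 2.
  have hε : Tendsto (fun n : ℕ => M * 2 ^ |β| * ((n : ℝ) + 1) ^ (-(β - (s + α)))) atTop (𝓝 0) := by
    have h := (tendsto_rpow_neg_atTop (sub_pos.2 hs)).comp
      (tendsto_atTop_add_const_right atTop (1 : ℝ) tendsto_natCast_atTop_atTop)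
    simpa using h.const_mul (M * 2 ^ |β|)
  have hM : 0 ≤ M := nonneg_of_mul_nonneg_left ((abs_nonneg _).trans (ha 0)) (by positivity)
  have key : ∀ (e : ℕ → ℝ) (σ : ℕ → ℕ), (∀ n : ℕ, |e n| ≤ M * ((n : ℝ) + 1) ^ s) →
      (∀ n, n + 1 ≤ 2 * (σ n + 1)) → (∀ n, σ n + 1 ≤ 2 * (n + 1)) → ∀ n : ℕ,
      |e n| * ((n : ℝ) + 1) ^ α
        ≤ M * 2 ^ |β| * ((n : ℝ) + 1) ^ (-(β - (s + α))) * ((σ n : ℝ) + 1) ^ β := by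
    intro e σ he h1 h2 n
    have h3 := rpow_le_two_mul β (x := (n : ℝ) + 1) (y := (σ n : ℝ) + 1) (by positivity)
      (by exact_mod_cast h1 n) (by exact_mod_cast h2 n)
    have hn : (0 : ℝ) < (n : ℝ) + 1 := by positivity
    calc |e n| * ((n : ℝ) + 1) ^ α ≤ M * ((n : ℝ) + 1) ^ s * ((n : ℝ) + 1) ^ α :=
          mul_le_mul_of_nonneg_right (he n) (by positivity)
      _ = M * ((n : ℝ) + 1) ^ (-(β - (s + α))) * ((n : ℝ) + 1) ^ β := by
          rw [mul_assoc, mul_assoc, ← Real.rpow_add hn, ← Real.rpow_add hn]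
          congr 2; ring
      _ ≤ M * ((n : ℝ) + 1) ^ (-(β - (s + α))) * (2 ^ |β| * ((σ n : ℝ) + 1) ^ β) :=
          mul_le_mul_of_nonneg_left h3 (by positivity)
      _ = _ := by ring
  obtain ⟨L1, h1, k1⟩ := WeightedSeq.exists_compact_comp (σ := id) Function.injective_id.injOn hε
    (key a id ha (fun n => by simp only [id]; omega) (fun n => by simp only [id]; omega))
  obtain ⟨L2, h2, k2⟩ := WeightedSeq.exists_compact_comp (σ := fun n => n + 1)
    (add_left_injective 1).injOn hε
    (key c _ hc (fun n => by omega) (fun n => by omega))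
  obtain ⟨L3, h3, k3⟩ := WeightedSeq.exists_compact_comp (σ := fun n => n - 1)
    -- Truncated subtraction sends both 0 and 1 to 0. The zero coefficient restores injectivity
    -- where it is needed and matches `triSeq`, which never reads `b 0`.
    (c := fun n => if n = 0 then 0 else b n)
    (by
      intro x hx y hy hxy
      simp only [Set.mem_ofPred_eq, ne_eq, ite_eq_left_iff, not_forall] at hx hy
      obtain ⟨hx, -⟩ := hx
      obtain ⟨hy, -⟩ := hy
      simp only at hxy
      omega) hε
    (key _ _ (fun n => by
      split_ifs
      · rw [abs_zero]; positivity
      · exact hb n) (fun n => by omega) (fun n => by omega))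
  refine ⟨L1 + L2 + L3, fun v n => ?_, (k1.add k2).add k3⟩
  rw [_root_.add_apply, _root_.add_apply, WeightedSeq.add_apply,
    WeightedSeq.add_apply, h1, h2, h3]
  cases n with
  | zero => simp [triSeq]
  | succ n =>
    simp [triSeq]
    ring

/-- Discrete Green identity: for a symmetric matrix the interior terms telescope and only the
Casoratian at the cut-off survives. -/
theorem sum_range_triSeq {a b c : ℕ → ℝ} (hbc : ∀ n, b (n + 1) = c n) (v w : ℕ → ℝ) (N : ℕ) :
    ∑ n ∈ Finset.range (N + 1), (v n * triSeq a b c w n - triSeq a b c v n * w n)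
      = c N * (v N * w (N + 1) - v (N + 1) * w N) := by
  induction N with
  | zero => simp [triSeq]; ring
  | succ N ih => rw [Finset.sum_range_succ, ih]; simp only [triSeq, hbc]; ring

theorem tsum_mul_triSeq {a b c v w : ℕ → ℝ} (hbc : ∀ n, b (n + 1) = c n)
    (hlim : Tendsto (fun n => c n * (v n * w (n + 1) - v (n + 1) * w n)) atTop (𝓝 0))
    (h1 : Summable fun n => v n * triSeq a b c w n)
    (h2 : Summable fun n => triSeq a b c v n * w n) :
    ∑' n, v n * triSeq a b c w n = ∑' n, triSeq a b c v n * w n := by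
  have h := ((h1.hasSum.sub h2.hasSum).tendsto_sum_nat).comp (tendsto_add_atTop_nat 1)
  refine sub_eq_zero.1 (tendsto_nhds_unique h (hlim.congr fun N => ?_))
  exact (sum_range_triSeq hbc v w N).symm

/-! ### Structure and size of the coefficients -/

/-- The factor `(2 k - 1) (2 k + 2)` of `μ` in `A_k(μ)`, with `k = n + 1`. -/
noncomputable def diagWeight (n : ℕ) : ℝ := (2 * n + 1) * (2 * n + 4)

theorem diagWeight_pos (n : ℕ) : 0 < diagWeight n := by unfold diagWeight; positivity

theorem sq_le_diagWeight (n : ℕ) : ((n : ℝ) + 1) ^ 2 ≤ diagWeight n := by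
  have hn : (0 : ℝ) ≤ n := Nat.cast_nonneg n
  unfold diagWeight
  nlinarith

theorem coeffA_eq (μ : ℝ) (n : ℕ) : coeffA μ (n + 1) = μ * diagWeight n + coeffA 0 (n + 1) := by
  unfold coeffA diagWeight
  push_cast
  ring

theorem seqOp_eq_triSeq (μ : ℝ) (v : ℕ → ℝ) : seqOp μ v = triSeq (fun n => coeffA μ (n + 1))
    (fun n => coeffB (n + 1)) (fun n => coeffC (n + 1)) v := by
  funext n
  cases n <;> rfl

theorem seqOp_eq (μ : ℝ) (v : ℕ → ℝ) (n : ℕ) :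
    seqOp μ v n = μ * diagWeight n * v n + seqOp 0 v n := by
  cases n with
  | zero => simp only [seqOp]; rw [show (1 : ℕ) = 0 + 1 from rfl, coeffA_eq μ]; ring
  | succ n => simp only [seqOp]; rw [coeffA_eq μ]; ring

/-- The weights of the squared differences in the quadratic form of `-𝒜(0)`. -/
noncomputable def bond (n : ℕ) : ℝ :=
  (2 * n + 4) * (2 * n + 1) * (2 * n + 3) / (4 * n + 7)

theorem bond_pos (n : ℕ) : 0 < bond n := by unfold bond; positivity

theorem bond_le (n : ℕ) : bond n ≤ 3 * ((n : ℝ) + 1) ^ 2 := by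
  have hn : (0 : ℝ) ≤ n := Nat.cast_nonneg n
  unfold bond
  rw [div_le_iff₀ (by positivity)]
  ring_nf
  nlinarith [pow_nonneg hn 2, pow_nonneg hn 3]

/-- The numbers `√(4 k + 1)`, with `k = n + 1`. -/
noncomputable def normFactor (n : ℕ) : ℝ := √(4 * n + 5)

theorem normFactor_sq (n : ℕ) : normFactor n ^ 2 = 4 * n + 5 := Real.sq_sqrt (by positivity)

theorem one_le_normFactor (n : ℕ) : 1 ≤ normFactor n := by
  refine Real.one_le_sqrt.2 ?_
  have hn : (0 : ℝ) ≤ n := Nat.cast_nonneg n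
  linarith

theorem normFactor_pos (n : ℕ) : 0 < normFactor n := zero_lt_one.trans_le (one_le_normFactor n)

/-- The root in C_k is a quotient of consecutive norm factors, and the square of one of them cancels
against the denominator. `coeffB_eq` reaches the same expression, which is the symmetry of the
matrix. -/
theorem coeffC_eq (n : ℕ) : coeffC (n + 1) = bond n / (normFactor n * normFactor (n + 1)) := by
  have h1 := normFactor_sq (n + 1)
  have hp := normFactor_pos n
  have hp1 := normFactor_pos (n + 1)
  have e : √((4 * ((n + 1 : ℕ) : ℝ) + 5) / (4 * ((n + 1 : ℕ) : ℝ) + 1))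
      = normFactor (n + 1) / normFactor n := by
    rw [Real.sqrt_div (by positivity)]
    unfold normFactor
    congr 2
    push_cast; ring
  unfold coeffC bond
  rw [e, div_mul_div_comm, div_div, div_eq_div_iff (by push_cast; positivity) (by positivity)]
  push_cast at h1 ⊢
  linear_combination ((2 * (n : ℝ) + 4) * (2 * n + 1) * (2 * n + 3) * normFactor n *
    (4 * n + 7)) * h1

theorem coeffB_eq (n : ℕ) : coeffB (n + 2) = bond n / (normFactor n * normFactor (n + 1)) := by
  have h1 := normFactor_sq n
  have hp := normFactor_pos n
  have hp1 := normFactor_pos (n + 1)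
  have e : √((4 * ((n + 2 : ℕ) : ℝ) - 3) / (4 * ((n + 2 : ℕ) : ℝ) + 1))
      = normFactor n / normFactor (n + 1) := by
    have hn : (0 : ℝ) ≤ n := Nat.cast_nonneg n
    rw [Real.sqrt_div (by push_cast; linarith)]
    unfold normFactor
    congr 2 <;> push_cast <;> ring
  have hd : ((4 * ((n + 2 : ℕ) : ℝ) - 3) * (4 * ((n + 2 : ℕ) : ℝ) - 1))
      = (4 * n + 5) * (4 * n + 7) := by push_cast; ring
  unfold coeffB bond
  rw [e, hd, div_mul_div_comm, div_div, div_eq_div_iff (by positivity) (by positivity)]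
  push_cast
  linear_combination ((2 * (n : ℝ) + 4) * (2 * n + 1) * (2 * n + 3) * normFactor (n + 1) *
    (4 * n + 7)) * h1

theorem coeffB_eq_coeffC (n : ℕ) : coeffB (n + 2) = coeffC (n + 1) :=
  (coeffB_eq n).trans (coeffC_eq n).symm

theorem coeffC_pos (n : ℕ) : 0 < coeffC (n + 1) := by
  rw [coeffC_eq]
  exact div_pos (bond_pos n) (mul_pos (normFactor_pos n) (normFactor_pos _))

theorem coeffA_zero_one : coeffA 0 1 = 2 / 15 - bond 0 / 5 := by
  norm_num [coeffA, bond]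

/-- The diagonal balances the two adjacent bonds, as in a weighted graph Laplacian. Only the first
row, in `coeffA_zero_one`, has the extra term 2/15. -/
theorem coeffA_zero_add_two (n : ℕ) :
    coeffA 0 (n + 2) = -(bond n + bond (n + 1)) / (4 * n + 9) := by
  unfold coeffA bond
  have h1 : (4 * ((n + 2 : ℕ) : ℝ) + 1) * (4 * ((n + 2 : ℕ) : ℝ) - 1)
      = (4 * n + 9) * (4 * n + 7) := by push_cast; ring
  have h2 : (4 * ((n + 2 : ℕ) : ℝ) + 1) * (4 * ((n + 2 : ℕ) : ℝ) + 3)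
      = (4 * n + 9) * (4 * n + 11) := by push_cast; ring
  have h3 : (4 * ((n + 1 : ℕ) : ℝ) + 7) = 4 * n + 11 := by push_cast; ring
  rw [h1, h2, h3]
  field_simp
  push_cast
  ring

theorem normFactor_mul_le (n : ℕ) :
    3 * ((n : ℝ) + 1) ≤ normFactor n * normFactor (n + 1) := by
  have hn : (0 : ℝ) ≤ n := Nat.cast_nonneg n
  refine le_of_sq_le_sq ?_ (mul_pos (normFactor_pos n) (normFactor_pos _)).le
  rw [mul_pow, mul_pow, normFactor_sq, normFactor_sq]
  push_cast
  nlinarith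

theorem abs_coeffC_le_linear (n : ℕ) : |coeffC (n + 1)| ≤ 2 * ((n : ℝ) + 1) := by
  have hn : (0 : ℝ) ≤ n := Nat.cast_nonneg n
  rw [abs_of_pos (coeffC_pos n), coeffC_eq,
    div_le_iff₀ (mul_pos (normFactor_pos n) (normFactor_pos _))]
  nlinarith [bond_le n, normFactor_mul_le n]

theorem abs_coeffB_le_linear (n : ℕ) : |coeffB (n + 1)| ≤ 2 * ((n : ℝ) + 1) := by
  cases n with
  -- This entry does not enter the operator, but `exists_compact_triSeq` asks for the bound at every
  -- index.
  | zero =>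
    have h : |√(1 / 5 : ℝ)| ≤ 1 := by
      rw [abs_of_nonneg (Real.sqrt_nonneg _), Real.sqrt_le_left (by norm_num)]
      norm_num
    unfold coeffB
    norm_num [abs_mul] at h ⊢
    linarith
  | succ n =>
    rw [coeffB_eq_coeffC]
    refine (abs_coeffC_le_linear n).trans ?_
    push_cast
    linarith

theorem abs_coeffA_zero_le_linear (n : ℕ) : |coeffA 0 (n + 1)| ≤ 2 * ((n : ℝ) + 1) := by
  cases n with
  | zero =>
    rw [zero_add, coeffA_zero_one, abs_le]
    constructor <;> norm_num [bond]
  | succ n =>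
    have hn : (0 : ℝ) ≤ n := Nat.cast_nonneg n
    have h1 := bond_le n
    have h2 := bond_le (n + 1)
    rw [coeffA_zero_add_two, neg_div, abs_neg,
      abs_of_pos (div_pos (add_pos (bond_pos _) (bond_pos _)) (by positivity)),
      div_le_iff₀ (by positivity)]
    push_cast at h2 ⊢
    nlinarith

/-! ### The recurrence and its decaying solutions for nonpositive μ -/

/-- A solution of the recurrence with vanishing first entry is zero. -/
theorem eq_zero_of_seqOp_eq_zero {μ : ℝ} {v : ℕ → ℝ} (h : seqOp μ v = 0) (h0 : v 0 = 0) :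
    v = 0 := by
  have key : ∀ n, v n = 0 ∧ v (n + 1) = 0 := by
    intro n
    induction n with
    | zero =>
      have h1 := congrFun h 0
      simp only [seqOp, h0, mul_zero, zero_add, Pi.zero_apply, mul_eq_zero] at h1
      exact ⟨h0, h1.resolve_left (coeffC_pos 0).ne'⟩
    | succ n ih =>
      have h1 := congrFun h (n + 1)
      simp only [seqOp, ih.1, ih.2, mul_zero, zero_add, Pi.zero_apply, mul_eq_zero] at h1
      exact ⟨ih.2, h1.resolve_left (coeffC_pos (n + 1)).ne'⟩
  exact funext fun n => (key n).1

theorem normFactor_mul_coeffC (n : ℕ) :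
    normFactor n * coeffC (n + 1) * normFactor (n + 1) = bond n := by
  have hp := normFactor_pos n
  have hp1 := normFactor_pos (n + 1)
  rw [coeffC_eq]
  field_simp

/-- In the variable u the operator at μ = 0 is a difference of fluxes. The first row keeps the
boundary term 2/3 u_1, so −𝒜(0) is not visibly positive and a quantitative argument is needed. -/
theorem normFactor_mul_seqOp_zero (μ : ℝ) (u : ℕ → ℝ) :
    normFactor 0 * seqOp μ (fun n => normFactor n * u n) 0
      = 20 * μ * u 0 + 2 / 3 * u 0 + bond 0 * (u 1 - u 0) := by
  have h := normFactor_mul_coeffC 0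
  have h0 := normFactor_sq 0
  simp only [seqOp]
  have hA : coeffA μ 1 = μ * diagWeight 0 + coeffA 0 1 := coeffA_eq μ 0
  rw [hA, coeffA_zero_one]
  norm_num [diagWeight] at h0 ⊢
  linear_combination u 1 * h + (μ * 4 + 2 / 15 - bond 0 / 5) * u 0 * h0

theorem normFactor_mul_seqOp_succ (μ : ℝ) (u : ℕ → ℝ) (n : ℕ) :
    normFactor (n + 1) * seqOp μ (fun n => normFactor n * u n) (n + 1)
      = μ * diagWeight (n + 1) * (4 * n + 9) * u (n + 1) + bond (n + 1) * (u (n + 2) - u (n + 1))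
        - bond n * (u (n + 1) - u n) := by
  have h := normFactor_mul_coeffC n
  have h1 := normFactor_mul_coeffC (n + 1)
  have h0 := normFactor_sq (n + 1)
  have hA : coeffA 0 (n + 2) * (4 * n + 9) = -(bond n + bond (n + 1)) := by
    rw [coeffA_zero_add_two, div_mul_cancel₀ _ (by positivity)]
  simp only [seqOp]
  rw [coeffB_eq_coeffC, coeffA_eq μ (n + 1)]
  push_cast at h0
  linear_combination u n * h + u (n + 2) * h1
    + (μ * diagWeight (n + 1) + coeffA 0 (n + 2)) * u (n + 1) * h0 + u (n + 1) * hA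

/-- Since 4n + 7 ≤ 2(2n + 4), the reciprocal of the bond is dominated by a telescoping term. The
dominating series has sum 1, which is what makes the loss 2/3 affordable. -/
theorem inv_bond_le (n : ℕ) : (bond n)⁻¹ ≤ (2 * (n : ℝ) + 1)⁻¹ - (2 * (n : ℝ) + 3)⁻¹ := by
  have hn : (0 : ℝ) ≤ n := Nat.cast_nonneg n
  unfold bond
  rw [inv_div, inv_sub_inv (by positivity) (by positivity),
    div_le_div_iff₀ (by positivity) (by positivity)]
  ring_nf
  nlinarith [pow_nonneg hn 2, pow_nonneg hn 3, pow_nonneg hn 4]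

/-- For `μ ≤ 0` a solution of the recurrence with positive first entry stays away from zero. -/
theorem third_le_of_seqOp_eq_zero {μ : ℝ} (hμ : μ ≤ 0) {u : ℕ → ℝ} (h0 : 0 < u 0)
    (h : seqOp μ (fun n => normFactor n * u n) = 0) (n : ℕ) : u 0 / 3 ≤ u n := by
  -- The first conjunct is u_0 minus 2/3 u_0 times the telescoped partial sum 1 − 1/(2n+1). The two
  -- conjuncts are coupled: positivity of u keeps the fluxes from decreasing, and the flux bound
  -- keeps u positive.
  have key : ∀ n : ℕ, u 0 * (1 / 3 + 2 / 3 * (2 * (n : ℝ) + 1)⁻¹) ≤ u n ∧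
      -(2 / 3) * u 0 ≤ bond n * (u (n + 1) - u n) := by
    intro n
    induction n with
    | zero =>
      have e := normFactor_mul_seqOp_zero μ u
      rw [h, Pi.zero_apply, mul_zero] at e
      refine ⟨by norm_num, ?_⟩
      simp only [zero_add]
      nlinarith [mul_nonneg (neg_nonneg.2 hμ) h0.le]
    | succ n ih =>
      have e := normFactor_mul_seqOp_succ μ u n
      rw [h, Pi.zero_apply, mul_zero] at e
      have hb := bond_pos n
      have h1 : u 0 * (1 / 3 + 2 / 3 * (2 * ((n + 1 : ℕ) : ℝ) + 1)⁻¹) ≤ u (n + 1) := by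
        have e1 : u (n + 1) - u n = (bond n)⁻¹ * (bond n * (u (n + 1) - u n)) := by
          rw [inv_mul_cancel_left₀ hb.ne']
        have e2 := mul_le_mul_of_nonneg_left ih.2 (inv_pos.2 hb).le
        have e3 := mul_le_mul_of_nonneg_left (inv_bond_le n) h0.le
        have e4 : (2 * ((n + 1 : ℕ) : ℝ) + 1)⁻¹ = (2 * (n : ℝ) + 3)⁻¹ := by
          congr 1; push_cast; ring
        rw [e4]
        linarith [ih.1]
      refine ⟨h1, ?_⟩
      have h2 : 0 ≤ u (n + 1) := le_trans (by positivity) h1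
      have h3 : 0 ≤ -μ * (diagWeight (n + 1) * (4 * n + 9) * u (n + 1)) :=
        mul_nonneg (neg_nonneg.2 hμ)
          (mul_nonneg (mul_nonneg (diagWeight_pos _).le (by positivity)) h2)
      linarith [ih.2]
  have h1 := (key n).1
  have h2 : 0 ≤ u 0 * (2 / 3 * (2 * (n : ℝ) + 1)⁻¹) := by positivity
  linarith

/-- A positive first entry contradicts decay, and so does a negative one after a change of sign.
Only convergence to 0 is used, so this serves both for h^{α+2} and for ℓ². -/
theorem eq_zero_of_seqOp_eq_zero_of_nonpos {μ : ℝ} (hμ : μ ≤ 0) {v : ℕ → ℝ} (h : seqOp μ v = 0)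
    (hv : Tendsto v atTop (𝓝 0)) : v = 0 := by
  have key : ∀ w : ℕ → ℝ, seqOp μ w = 0 → Tendsto w atTop (𝓝 0) → w 0 ≤ 0 := by
    intro w hw hlim
    by_contra! hpos
    have hu : (fun n => normFactor n * (w n / normFactor n)) = w :=
      funext fun n => mul_div_cancel₀ _ (normFactor_pos n).ne'
    have h0 : 0 < w 0 / normFactor 0 := div_pos hpos (normFactor_pos 0)
    have hle : ∀ n, w 0 / normFactor 0 / 3 ≤ w n := fun n => by
      have h1 := third_le_of_seqOp_eq_zero hμ (u := fun n => w n / normFactor n) h0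
        (by rw [hu, hw]) n
      refine h1.trans (div_le_self ?_ (one_le_normFactor n))
      by_contra! hneg
      have h2 : w n / normFactor n < 0 := div_neg_of_neg_of_pos hneg (normFactor_pos n)
      linarith
    have := ge_of_tendsto' hlim hle
    linarith
  refine eq_zero_of_seqOp_eq_zero h (le_antisymm (key v h hv) ?_)
  have h1 := key ((-1 : ℝ) • v) (by rw [seqOp_smul, h, smul_zero]) (by
    simpa using! hv.const_smul (-1 : ℝ))
  simpa using h1

/-! ### Fredholm theory and symmetry of 𝒜(μ) -/

/-- The Fredholm alternative for a compact perturbation of a multiple of an isomorphism. -/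
theorem ContinuousLinearEquiv.isInvertible_smul_add_compact {E F : Type*} [NormedAddCommGroup E]
    [NormedSpace ℝ E] [NormedAddCommGroup F] [NormedSpace ℝ F] [CompleteSpace E] [CompleteSpace F]
    (D : E ≃L[ℝ] F) {G : E →L[ℝ] F} (hG : IsCompactOperator G) {μ : ℝ} (hμ : μ ≠ 0)
    (hker : ∀ x, μ • D x + G x = 0 → x = 0) :
    (μ • (D : E →L[ℝ] F) + G).IsInvertible := by
  -- With T = −GD⁻¹ one has μD + G = (μ − T)D, so the spectral alternative for the compact
  -- endomorphism T at μ ≠ 0 decides.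
  let T : F →L[ℝ] F := -(G ∘L (D.symm : F →L[ℝ] E))
  have hTx : ∀ x, T (D x) = -G x := fun x => by simp [T]
  have hT : IsCompactOperator T := (hG.comp_clm (D.symm : F →L[ℝ] E)).neg
  rcases hT.hasEigenvalue_or_mem_resolventSet hμ with h | h
  · obtain ⟨f, hf⟩ := h.exists_hasEigenvector
    have h1 : T f = μ • f := hf.apply_eq_smul
    have h2 := hTx (D.symm f)
    rw [D.apply_symm_apply, h1] at h2
    have h3 := hker (D.symm f) (by rw [D.apply_symm_apply, h2, neg_add_cancel])
    exact absurd (D.symm.map_eq_zero_iff.1 h3) hf.2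
  · have hu := ContinuousLinearMap.isUnit_iff_bijective.1 (spectrum.mem_resolventSet_iff.1 h)
    have he : ∀ x, (μ • (D : E →L[ℝ] F) + G) x = (algebraMap ℝ (F →L[ℝ] F) μ - T) (D x) := by
      intro x
      rw [_root_.sub_apply, hTx, Algebra.algebraMap_eq_smul_one]
      simp
    have hk : (μ • (D : E →L[ℝ] F) + G).ker = ⊥ := LinearMap.ker_eq_bot'.2 fun x hx => hker x hx
    have hr : (μ • (D : E →L[ℝ] F) + G).range = ⊤ := by
      refine LinearMap.range_eq_top.2 fun f => ?_
      obtain ⟨g, hg⟩ := hu.2 f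
      exact ⟨D.symm g, (he _).trans (by rw [D.apply_symm_apply, hg])⟩
    exact ⟨ContinuousLinearEquiv.ofBijective _ hk hr, ContinuousLinearEquiv.coe_ofBijective _ hk hr⟩

theorem hSubmodule_antitone {α β : ℝ} (h : α ≤ β) : hSubmodule β ≤ hSubmodule α := fun v hv =>
  Summable.of_nonneg_of_le (fun n => by positivity) (fun n =>
    mul_le_mul_of_nonneg_right (Real.rpow_le_rpow_of_exponent_le (by simp) (by linarith))
      (sq_nonneg _)) hv

theorem summable_mul_of_mem {v w : ℕ → ℝ} (hv : v ∈ hSubmodule 0) (hw : w ∈ hSubmodule 0) :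
    Summable fun n => v n * w n := by
  have h1 : Summable fun n : ℕ => ((n : ℝ) + 1) ^ (2 * (0 : ℝ)) * v n ^ 2 := hv
  have h2 : Summable fun n : ℕ => ((n : ℝ) + 1) ^ (2 * (0 : ℝ)) * w n ^ 2 := hw
  simp only [mul_zero, Real.rpow_zero, one_mul] at h1 h2
  refine Summable.of_norm_bounded (h1.add h2) fun n => ?_
  rw [Real.norm_eq_abs, abs_le]
  constructor <;> nlinarith [sq_nonneg (v n + w n), sq_nonneg (v n - w n), sq_nonneg (v n),
    sq_nonneg (w n)]

theorem tendsto_rpow_mul_of_mem {α : ℝ} {v : ℕ → ℝ} (hv : v ∈ hSubmodule α) :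
    Tendsto (fun n : ℕ => ((n : ℝ) + 1) ^ α * v n) atTop (𝓝 0) := by
  have h : Tendsto (fun n : ℕ => ((n : ℝ) + 1) ^ (2 * α) * v n ^ 2) atTop (𝓝 0) :=
    Summable.tendsto_atTop_zero hv
  have h2 := h.sqrt
  rw [Real.sqrt_zero] at h2
  refine tendsto_zero_iff_abs_tendsto_zero _ |>.2 (h2.congr fun n => ?_)
  rw [← WeightedSeq.weight_sq, Real.sqrt_sq_eq_abs]
  rfl

theorem tendsto_zero_of_mem {α : ℝ} (hα : 0 ≤ α) {v : ℕ → ℝ} (hv : v ∈ hSubmodule α) :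
    Tendsto v atTop (𝓝 0) := by
  simpa using tendsto_rpow_mul_of_mem (hSubmodule_antitone hα hv)

theorem WeightedSeq.ext_toSeq {α : ℝ} {v w : WeightedSeq α} (h : toSeq α v = toSeq α w) : v = w :=
  ext fun n => congrFun h n

/-- The derivative of `μ ↦ 𝒜(μ)`. -/
noncomputable def diagOp (α : ℝ) : WeightedSeq (α + 2) →L[ℝ] WeightedSeq α := opA α 1 - opA α 0

theorem diagOp_apply (α : ℝ) (v : WeightedSeq (α + 2)) (n : ℕ) :
    diagOp α v n = diagWeight n * v n := by
  rw [diagOp, _root_.sub_apply, WeightedSeq.sub_apply, opA_apply, opA_apply, seqOp_eq 1]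
  ring

theorem opA_eq (α μ : ℝ) : opA α μ = μ • diagOp α + opA α 0 := by
  ext1 v
  refine WeightedSeq.ext fun n => ?_
  rw [_root_.add_apply, _root_.smul_apply, WeightedSeq.add_apply, WeightedSeq.smul_apply,
    diagOp_apply, opA_apply, opA_apply, seqOp_eq μ]
  ring

theorem hasDerivAt_opA (α μ : ℝ) : HasDerivAt (fun μ : ℝ => opA α μ) (diagOp α) μ := by
  have h := ((hasDerivAt_id μ).smul_const (diagOp α)).add_const (opA α 0)
  rw [one_smul] at h
  exact h.congr_of_eventuallyEq (Eventually.of_forall fun ν => opA_eq α ν)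

theorem isCompactOperator_opA_zero (α : ℝ) : IsCompactOperator (opA α 0) := by
  obtain ⟨L, hL, hc⟩ := exists_compact_triSeq (α := α) (β := α + 2) (s := 1) (M := 2)
    (a := fun n => coeffA 0 (n + 1)) (b := fun n => coeffB (n + 1)) (c := fun n => coeffC (n + 1))
    (fun n => by simpa using abs_coeffA_zero_le_linear n)
    (fun n => by simpa using abs_coeffB_le_linear n)
    (fun n => by simpa using abs_coeffC_le_linear n) (by linarith)
  have : opA α 0 = L := by
    ext1 v
    refine WeightedSeq.ext fun n => ?_
    rw [hL, opA_apply, seqOp_eq_triSeq]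
  rwa [this]

theorem diagOp_ker (α : ℝ) : (diagOp α).ker = ⊥ := by
  refine LinearMap.ker_eq_bot'.2 fun v hv => WeightedSeq.ext fun n => ?_
  have h := congrArg (fun w : WeightedSeq α => w n) hv
  have h1 : diagOp α v n = 0 := h.trans (WeightedSeq.zero_apply n)
  rw [diagOp_apply] at h1
  rw [WeightedSeq.zero_apply]
  exact (mul_eq_zero.1 h1).resolve_left (diagWeight_pos n).ne'

theorem diagOp_range (α : ℝ) : (diagOp α).range = ⊤ := by
  refine LinearMap.range_eq_top.2 fun f => ?_
  obtain ⟨w, hw, -⟩ := WeightedSeq.comp_bound (α := α + 2) (M := 1) (σ := id)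
    (c := fun n => (diagWeight n)⁻¹) Function.injective_id.injOn (fun n => by
      rw [abs_of_pos (inv_pos.2 (diagWeight_pos n)), one_mul, inv_mul_le_iff₀ (diagWeight_pos n),
        Real.rpow_add (by positivity), mul_comm]
      refine mul_le_mul_of_nonneg_right ?_ (by positivity)
      simpa using sq_le_diagWeight n) f
  refine ⟨w, WeightedSeq.ext fun n => (diagOp_apply α w n).trans ?_⟩
  rw [hw, mul_inv_cancel_left₀ (diagWeight_pos n).ne']
  rfl

/-- The diagonal operator as an isomorphism. -/
noncomputable def diagEquiv (α : ℝ) : WeightedSeq (α + 2) ≃L[ℝ] WeightedSeq α :=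
  ContinuousLinearEquiv.ofBijective (diagOp α) (diagOp_ker α) (diagOp_range α)

theorem coe_diagEquiv (α : ℝ) :
    (diagEquiv α : WeightedSeq (α + 2) →L[ℝ] WeightedSeq α) = diagOp α :=
  ContinuousLinearEquiv.coe_ofBijective _ _ _

/-- The compact summand P covers both uses: P = 0 for injective 𝒜(μ), and the rank-one correction
when there is a nullspace. -/
theorem isInvertible_opA_add {α μ : ℝ} (hμ : μ ≠ 0) {P : WeightedSeq (α + 2) →L[ℝ] WeightedSeq α}
    (hP : IsCompactOperator P) (hker : ∀ v, opA α μ v + P v = 0 → v = 0) :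
    (opA α μ + P).IsInvertible := by
  have h := (diagEquiv α).isInvertible_smul_add_compact (G := opA α 0 + P)
    ((isCompactOperator_opA_zero α).add hP) hμ (fun v hv => hker v (by
      rw [opA_eq, ← hv, ← coe_diagEquiv]
      simp [add_assoc]))
  rw [coe_diagEquiv, ← add_assoc, ← opA_eq] at h
  exact h

theorem isInvertible_opA {α μ : ℝ} (hμ : μ ≠ 0) (hker : (opA α μ).ker = ⊥) :
    (opA α μ).IsInvertible := by
  have h := isInvertible_opA_add hμ (P := 0) isCompactOperator_zero fun v hv =>
    LinearMap.ker_eq_bot'.1 hker v (by simpa using hv)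
  rwa [add_zero] at h

theorem mem_ker_opA {α μ : ℝ} {v : WeightedSeq (α + 2)} :
    v ∈ (opA α μ).ker ↔ seqOp μ v = 0 := by
  rw [LinearMap.mem_ker]
  constructor
  · intro h
    funext n
    exact (congrArg (fun w : WeightedSeq α => w n) h).trans (WeightedSeq.zero_apply n)
  · exact fun h => WeightedSeq.ext fun n => (congrFun h n).trans (WeightedSeq.zero_apply n).symm

theorem summable_mul_opA {α : ℝ} (hα : 0 ≤ α) (v : WeightedSeq (α + 2)) (f : WeightedSeq α) :
    Summable fun n => v n * f n :=
  summable_mul_of_mem (hSubmodule_antitone (by linarith) v.mem) (hSubmodule_antitone hα f.mem)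

theorem isEllTwoSymmetric_opA {α : ℝ} (hα : 0 ≤ α) (μ : ℝ) : IsEllTwoSymmetric (opA α μ) := by
  intro v w
  have h1 := summable_mul_opA hα v (opA α μ w)
  have h2 : Summable fun n => opA α μ v n * w n := by
    simpa only [mul_comm] using summable_mul_opA hα w (opA α μ v)
  refine ⟨h1, h2, ?_⟩
  simp only [opA_apply, seqOp_eq_triSeq] at h1 h2 ⊢
  refine tsum_mul_triSeq coeffB_eq_coeffC ?_ h1 h2
  -- The coefficient C_n grows linearly, so the boundary term vanishes once one factor absorbs n.
  -- This needs h^1, which contains h^{α+2}.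
  have lim : ∀ x : WeightedSeq (α + 2),
      Tendsto (fun n : ℕ => ((n : ℝ) + 1) * x n) atTop (𝓝 0) := fun x => by
    simpa using tendsto_rpow_mul_of_mem (α := 1) (hSubmodule_antitone (by linarith) x.mem)
  have lim0 : ∀ x : WeightedSeq (α + 2), Tendsto (fun n : ℕ => x (n + 1)) atTop (𝓝 0) := fun x =>
    (tendsto_zero_of_mem (by linarith) x.mem).comp (tendsto_add_atTop_nat 1)
  have hbound := (((lim v).mul (lim0 w)).abs.add ((lim w).mul (lim0 v)).abs).const_mul 2
  simp only [mul_zero, abs_zero, add_zero] at hbound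
  refine squeeze_zero_norm (fun n => ?_) hbound
  have hn : (0 : ℝ) ≤ (n : ℝ) + 1 := by positivity
  rw [Real.norm_eq_abs, abs_mul]
  calc _ ≤ 2 * ((n : ℝ) + 1) * (|v n * w (n + 1)| + |v (n + 1) * w n|) :=
        mul_le_mul (abs_coeffC_le_linear n) (abs_sub _ _) (abs_nonneg _) (by positivity)
    _ = _ := by
        simp only [abs_mul, abs_of_nonneg hn]
        ring

/-- Elements of the range are orthogonal to the kernel. -/
theorem tsum_mul_opA_eq_zero {α : ℝ} (hα : 0 ≤ α) {μ : ℝ} {v : WeightedSeq (α + 2)}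
    (hv : v ∈ (opA α μ).ker) (w : WeightedSeq (α + 2)) : ∑' n, v n * opA α μ w n = 0 := by
  rw [(isEllTwoSymmetric_opA hα μ v w).2.2]
  simp only [opA_apply, mem_ker_opA.1 hv, Pi.zero_apply, zero_mul, tsum_zero]

theorem apply_zero_ne_zero_of_mem_ker {α μ : ℝ} {v : WeightedSeq (α + 2)}
    (hv : v ∈ (opA α μ).ker) (h0 : v ≠ 0) : v 0 ≠ 0 := fun h =>
  h0 (WeightedSeq.ext_toSeq ((eq_zero_of_seqOp_eq_zero (mem_ker_opA.1 hv) h).trans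
    (map_zero _).symm))

theorem finrank_ker_opA {α μ : ℝ} (h : (opA α μ).ker ≠ ⊥) :
    Module.finrank ℝ (opA α μ).ker = 1 := by
  obtain ⟨v, hv, h0⟩ := Submodule.exists_mem_ne_zero_of_ne_bot h
  have hv0 := apply_zero_ne_zero_of_mem_ker hv h0
  refine finrank_eq_one (⟨v, hv⟩ : (opA α μ).ker) (fun e => h0 (congrArg Subtype.val e)) ?_
  rintro ⟨w, hw⟩
  refine ⟨w 0 / v 0, Subtype.ext ?_⟩
  -- This combination has first entry zero, so the recurrence forces it to vanish.
  have hmem : (w 0 / v 0) • v - w ∈ (opA α μ).ker :=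
    Submodule.sub_mem _ (Submodule.smul_mem _ _ hv) hw
  by_contra hne
  refine apply_zero_ne_zero_of_mem_ker hmem (sub_ne_zero.2 hne) ?_
  rw [WeightedSeq.sub_apply, WeightedSeq.smul_apply, div_mul_cancel₀ _ hv0, sub_self]

theorem rank_ker_opA_le (α μ : ℝ) : Module.rank ℝ (opA α μ).ker ≤ 1 := by
  by_cases h : (opA α μ).ker = ⊥
  · rw [h]; simp
  · exact (Module.rank_eq_one_iff_finrank_eq_one.2 (finrank_ker_opA h)).le

open scoped LinearMap.FiniteRangeSetoid in
-- The inverse of A + P inverts A modulo finite rank.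
theorem ContinuousLinearMap.isFredholm_of_isInvertible_add {E F : Type*} [NormedAddCommGroup E]
    [NormedSpace ℝ E] [NormedAddCommGroup F] [NormedSpace ℝ F] {A P : E →L[ℝ] F}
    (h : (A + P).IsInvertible) (hP : (P : E →ₗ[ℝ] F).HasNoetherianRange) : A.IsFredholm := by
  obtain ⟨e, he⟩ := h
  refine ContinuousLinearMap.IsFredholm.of_isQuasiInverse
    (v := (e.symm : F →L[ℝ] E)) ?_
  refine e.toLinearEquiv.isQuasiInverse.congr (Setoid.refl _) ?_
  rw [LinearMap.FiniteRangeSetoid.equiv_iff_hasNoetherianRange]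
  have : (A : E →ₗ[ℝ] F) - (e.toLinearEquiv : E →ₗ[ℝ] F) = (-1 : ℝ) • (P : E →ₗ[ℝ] F) := by
    ext x
    have hx : e x = A x + P x := by
      rw [← ContinuousLinearEquiv.coe_coe, he]
      rfl
    simp [hx]
  rw [this]
  exact hP.smul _

theorem isFredholmOfIndexZero_opA {α : ℝ} (hα : 0 ≤ α) {μ : ℝ} (hμ : μ ≠ 0) :
    IsFredholmOfIndexZero (opA α μ) := by
  by_cases h : (opA α μ).ker = ⊥
  · have hinv := isInvertible_opA hμ h
    refine ⟨ContinuousLinearMap.isFredholm_of_isInvertible_add (P := 0) (by rwa [add_zero])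
      LinearMap.HasNoetherianRange.zero, ?_⟩
    have hr : (opA α μ).range = ⊤ := by
      obtain ⟨e, he⟩ := hinv
      rw [← he]
      exact LinearMap.range_eq_top.2 e.surjective
    rw [h, hr, finrank_bot, Module.finrank_zero_of_subsingleton]
    rfl
  · obtain ⟨v, hv, h0⟩ := Submodule.exists_mem_ne_zero_of_ne_bot h
    have hv0 := apply_zero_ne_zero_of_mem_ker hv h0
    let e₀ : WeightedSeq α := WeightedSeq.unitSeq α 0
    let P : WeightedSeq (α + 2) →L[ℝ] WeightedSeq α :=
      (WeightedSeq.evalCLM (α + 2) 0).smulRight e₀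
    have hPx : ∀ x, P x = x 0 • e₀ := fun x => rfl
    have pair : ∀ (x : WeightedSeq (α + 2)), ∑' n, v n * (x 0 • e₀) n = v 0 * x 0 := by
      intro x
      rw [tsum_eq_single 0 fun n hn => by
        simp only [WeightedSeq.smul_apply, e₀, WeightedSeq.unitSeq_apply, hn, if_false, mul_zero]]
      simp only [WeightedSeq.smul_apply, e₀, WeightedSeq.unitSeq_apply, if_true, mul_one]
    -- Pairing with the null vector v, whose first entry is nonzero, shows that no nonzero multiple
    -- of e₀ lies in the range. This gives both injectivity of 𝒜(μ) + P and a nontrivial cokernel.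
    have hzero : ∀ x y : WeightedSeq (α + 2), opA α μ y = x 0 • e₀ → x 0 = 0 := by
      intro x y hxy
      have h1 := tsum_mul_opA_eq_zero hα hv y
      rw [hxy, pair] at h1
      exact (mul_eq_zero.1 h1).resolve_left hv0
    have hinv : (opA α μ + P).IsInvertible := by
      refine isInvertible_opA_add hμ ?_ fun x hx => ?_
      · exact (isCompactOperator_of_locallyCompactSpace_dom
          (WeightedSeq.evalCLM (α + 2) 0)).clm_comp (ContinuousLinearMap.toSpanSingleton ℝ e₀)
      · have hx0 : x 0 = 0 := hzero x (-x) (by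
          rw [map_neg, ← hPx, eq_comm, ← sub_eq_zero, sub_neg_eq_add, add_comm, hx])
        rw [hPx, hx0, zero_smul, add_zero] at hx
        by_contra hne
        exact apply_zero_ne_zero_of_mem_ker (LinearMap.mem_ker.2 hx) hne hx0
    refine ⟨ContinuousLinearMap.isFredholm_of_isInvertible_add hinv ?_, ?_⟩
    · exact (LinearMap.HasNoetherianRange.of_isNoetherian_rng
        (f := (WeightedSeq.evalCLM (α + 2) 0 : WeightedSeq (α + 2) →ₗ[ℝ] ℝ))).comp_left
        (LinearMap.toSpanSingleton ℝ _ e₀)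
    · have hq : Module.finrank ℝ (WeightedSeq α ⧸ (opA α μ).range) = 1 := by
        refine finrank_eq_one (Submodule.Quotient.mk e₀) ?_ ?_
        · intro hq
          obtain ⟨y, hy⟩ := (Submodule.Quotient.mk_eq_zero _).1 hq
          have h1 : (WeightedSeq.unitSeq (α + 2) 0) 0 = 1 := by
            rw [WeightedSeq.unitSeq_apply, if_pos rfl]
          have h2 := hzero (WeightedSeq.unitSeq (α + 2) 0) y (by rw [h1, one_smul]; exact hy)
          rw [h1] at h2
          exact one_ne_zero h2
        · intro q
          obtain ⟨f, rfl⟩ := Submodule.Quotient.mk_surjective _ q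
          obtain ⟨e, he⟩ := hinv
          -- Solving with 𝒜(μ) + P writes every f as a range element plus a multiple of e₀, so e₀
          -- spans the cokernel.
          have hf : opA α μ (e.symm f) + (e.symm f) 0 • e₀ = f := by
            rw [← hPx, ← _root_.add_apply, ← he]
            exact e.apply_symm_apply f
          refine ⟨(e.symm f) 0, ?_⟩
          rw [← Submodule.Quotient.mk_smul, Submodule.Quotient.eq]
          refine ⟨-e.symm f, ?_⟩
          change opA α μ (-e.symm f) = _
          rw [map_neg, neg_eq_iff_eq_neg, neg_sub, eq_sub_iff_add_eq, hf]
      rw [finrank_ker_opA h, hq]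
      rfl

/-! ### Regularity of null vectors and transversality -/

/-- Solutions of the recurrence gain half a derivative. -/
theorem mem_hSubmodule_add_half {μ s : ℝ} (hμ : μ ≠ 0) {v : ℕ → ℝ} (h : seqOp μ v = 0)
    (hv : v ∈ hSubmodule s) : v ∈ hSubmodule (s + 1 / 2) := by
  have hbound : ∀ (c : ℕ → ℝ), (∀ n : ℕ, |c n| ≤ 2 * ((n : ℝ) + 1)) → ∀ n : ℕ,
      |-c n / (μ * diagWeight n)| ≤ 2 / |μ| * ((n : ℝ) + 1) ^ (-1 : ℝ) := by
    intro c hc n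
    have hd := diagWeight_pos n
    have hμ' := abs_pos.2 hμ
    rw [Real.rpow_neg_one, abs_div, abs_neg, abs_mul, abs_of_pos hd, ← div_eq_mul_inv, div_div,
      div_le_div_iff₀ (by positivity) (by positivity)]
    have h1 := mul_le_mul (hc n) (le_refl (|μ| * ((n : ℝ) + 1))) (by positivity) (by positivity)
    nlinarith [mul_le_mul_of_nonneg_left (sq_le_diagWeight n) hμ'.le]
  -- L is −(μD)⁻¹𝒜(0), which fixes v. Its entries are of order 1/n, so any gain below one derivative
  -- satisfies the strict inequality.
  obtain ⟨L, hL, -⟩ := exists_compact_triSeq (α := s + 1 / 2) (β := s)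
    (hbound _ abs_coeffA_zero_le_linear) (hbound _ abs_coeffB_le_linear)
    (hbound _ abs_coeffC_le_linear) (by linarith)
  have hLv : WeightedSeq.toSeq _ (L (WeightedSeq.mk v hv)) = v := by
    funext n
    have hd : μ * diagWeight n ≠ 0 := mul_ne_zero hμ (diagWeight_pos n).ne'
    have h1 := congrFun h n
    rw [seqOp_eq, Pi.zero_apply] at h1
    refine (hL _ n).trans ?_
    have h2 : ∀ n, triSeq (fun n => -coeffA 0 (n + 1) / (μ * diagWeight n))
        (fun n => -coeffB (n + 1) / (μ * diagWeight n))
        (fun n => -coeffC (n + 1) / (μ * diagWeight n)) v n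
        = -seqOp 0 v n / (μ * diagWeight n) := by
      rintro (_ | n) <;> simp only [triSeq, seqOp] <;> ring
    refine (h2 n).trans ?_
    rw [div_eq_iff hd]
    linear_combination -h1
  rw [← hLv]
  exact WeightedSeq.mem _

theorem mem_hSubmodule_of_seqOp_eq_zero {μ : ℝ} (hμ : μ ≠ 0) {v : ℕ → ℝ} (h : seqOp μ v = 0)
    (hv : v ∈ hSubmodule 0) (β : ℝ) : v ∈ hSubmodule β := by
  have key : ∀ k : ℕ, v ∈ hSubmodule ((k : ℝ) / 2) := by
    intro k
    induction k with
    | zero => simpa using hv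
    | succ k ih =>
      have := mem_hSubmodule_add_half hμ h ih
      convert this using 2
      push_cast
      ring
  obtain ⟨k, hk⟩ := exists_nat_ge (2 * β)
  exact hSubmodule_antitone (by linarith) (key k)

theorem ker_opA_eq_bot_of_nonpos {α : ℝ} (hα : 0 ≤ α) {μ : ℝ} (hμ : μ ≤ 0) :
    (opA α μ).ker = ⊥ :=
  (Submodule.eq_bot_iff _).2 fun v hv => WeightedSeq.ext_toSeq
    ((eq_zero_of_seqOp_eq_zero_of_nonpos hμ (mem_ker_opA.1 hv)
      (tendsto_zero_of_mem (by linarith) v.mem)).trans (map_zero _).symm)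

/-- Orthogonality of range and nullspace would give ∑ `diagWeight n` v_n² = 0, a sum of nonnegative
terms whose first one is positive. -/
theorem diagOp_notMem_range {α : ℝ} (hα : 0 ≤ α) {μ : ℝ} {v : WeightedSeq (α + 2)}
    (hv : v ∈ (opA α μ).ker) (h0 : v ≠ 0) : diagOp α v ∉ (opA α μ).range := by
  rintro ⟨w, hw⟩
  have h1 := tsum_mul_opA_eq_zero hα hv w
  have h2 : opA α μ w = diagOp α v := hw
  have hs := summable_mul_opA hα v (diagOp α v)
  rw [h2] at h1
  have hnn : ∀ n, 0 ≤ v n * diagOp α v n := fun n => by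
    rw [diagOp_apply, mul_left_comm]
    exact mul_nonneg (diagWeight_pos n).le (mul_self_nonneg _)
  have h3 := congrFun ((hasSum_zero_iff_of_nonneg hnn).1 (h1 ▸ hs.hasSum)) 0
  simp only [diagOp_apply, Pi.zero_apply, mul_eq_zero, (diagWeight_pos 0).ne', false_or,
    or_self] at h3
  exact apply_zero_ne_zero_of_mem_ker hv h0 h3

/-! ### Enumeration of a discrete set of positive numbers -/

/-- A set of positive numbers that is infinite and accumulates only at zero is the range of a
strictly decreasing sequence with limit zero. -/
theorem exists_strictAnti_range_eq {S : Set ℝ} (hpos : ∀ x ∈ S, 0 < x) (hinf : S.Infinite)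
    (hfin : ∀ ε > 0, {x | x ∈ S ∧ ε ≤ x}.Finite) :
    ∃ m : ℕ → ℝ, StrictAnti m ∧ Set.range m = S ∧ Tendsto m atTop (𝓝 0) := by
  have hgr : ∀ T ⊆ S, T.Nonempty → ∃ x ∈ T, ∀ z ∈ T, z ≤ x := by
    rintro T hT ⟨y, hy⟩
    obtain ⟨x, hx, hx'⟩ := ((hfin y (hpos y (hT hy))).subset
      (fun z (hz : z ∈ {z | z ∈ T ∧ y ≤ z}) => ⟨hT hz.1, hz.2⟩)).exists_maximalFor id _
        ⟨y, hy, le_rfl⟩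
    refine ⟨x, hx.1, fun z hz => ?_⟩
    by_contra! hlt
    exact absurd (hx' (show z ∈ {z | z ∈ T ∧ y ≤ z} from ⟨hz, hx.2.trans hlt.le⟩) hlt.le)
      (not_le.2 hlt)
  have hne : ∀ y ∈ S, {x | x ∈ S ∧ x < y}.Nonempty := fun y hy => by
    by_contra h
    refine hinf ((hfin y (hpos y hy)).subset fun x hx => ⟨hx, ?_⟩)
    by_contra! hlt
    exact h ⟨x, hx, hlt⟩
  obtain ⟨x₀, hx₀, hx₀'⟩ := hgr S subset_rfl hinf.nonempty
  choose f hf hf' using fun y : S => hgr {x | x ∈ S ∧ x < y} (fun x hx => hx.1) (hne y y.2)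
  -- Greedy enumeration: each term is the greatest element of S below the previous one. An element
  -- that is missed would lie below all terms, although these become arbitrarily small.
  let g : ℕ → S := fun n => Nat.rec (motive := fun _ => S) ⟨x₀, hx₀⟩ (fun _ y => ⟨f y, (hf y).1⟩) n
  have hanti : StrictAnti fun n => (g n : ℝ) := strictAnti_nat_of_succ_lt fun n => (hf (g n)).2
  have hsmall : ∀ ε > 0, ∃ n, (g n : ℝ) < ε := fun ε hε => by
    by_contra! h
    exact Set.infinite_range_of_injective hanti.injective ((hfin ε hε).subset (by
      rintro _ ⟨n, rfl⟩
      exact ⟨(g n).2, h n⟩))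
  refine ⟨fun n => g n, hanti, Set.Subset.antisymm ?_ fun x hx => ?_, ?_⟩
  · rintro _ ⟨n, rfl⟩
    exact (g n).2
  · by_contra hx'
    have hlt : ∀ n, x < g n := by
      intro n
      induction n with
      | zero => exact lt_of_le_of_ne (hx₀' x hx) fun h => hx' ⟨0, h.symm⟩
      | succ n ih =>
        exact lt_of_le_of_ne (hf' (g n) x ⟨hx, ih⟩) fun h => hx' ⟨n + 1, h.symm⟩
    obtain ⟨n, hn⟩ := hsmall x (hpos x hx)
    exact lt_asymm hn (hlt n)
  · rw [Metric.tendsto_atTop]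
    intro ε hε
    obtain ⟨N, hN⟩ := hsmall ε hε
    refine ⟨N, fun n hn => ?_⟩
    rw [Real.dist_0_eq_abs, abs_of_pos (hpos _ (g n).2)]
    exact (hanti.antitone hn).trans_lt hN

/-! ### Eigenvalues of compact symmetric operators -/

section CompactSymmetric

open Module.End

variable {H : Type*} [NormedAddCommGroup H] [InnerProductSpace ℝ H] {T : H →L[ℝ] H}

/-- Each eigenspace is finite-dimensional, the one at 0 being trivial. Finitely many eigenvalues
would give a finite-dimensional span, but by the spectral theorem its orthogonal complement is zero,
so it would be all of H. -/
theorem infinite_setOf_hasEigenvalue [CompleteSpace H] (hT : IsCompactOperator T)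
    (hT' : T.IsSymmetric) (h0 : ¬ HasEigenvalue (T : Module.End ℝ H) 0)
    (hH : ¬ FiniteDimensional ℝ H) : {μ | HasEigenvalue (T : Module.End ℝ H) μ}.Infinite := by
  intro hfin
  have hd : ∀ μ : ℝ, FiniteDimensional ℝ (eigenspace (T : Module.End ℝ H) μ) := fun μ => by
    by_cases hμ : μ = 0
    · rw [hasEigenvalue_iff, not_not] at h0
      rw [hμ, h0]
      infer_instance
    · exact ContinuousLinearMap.finite_dimensional_eigenspace hT μ hμ
  have hle : (⨆ μ, eigenspace (T : Module.End ℝ H) μ)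
      = ⨆ μ ∈ hfin.toFinset, eigenspace (T : Module.End ℝ H) μ := by
    refine le_antisymm (iSup_le fun μ => ?_) (iSup₂_le fun μ _ => le_iSup _ μ)
    by_cases hμ : HasEigenvalue (T : Module.End ℝ H) μ
    · exact le_iSup₂_of_le μ (hfin.mem_toFinset.2 hμ) le_rfl
    · rw [hasEigenvalue_iff, not_not] at hμ
      rw [hμ]
      exact bot_le
  have hfd : FiniteDimensional ℝ (⨆ μ, eigenspace (T : Module.End ℝ H) μ : Submodule ℝ H) := by
    rw [hle]
    exact Submodule.finiteDimensional_finset_sup hfin.toFinset _ |> (by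
      rw [← Finset.sup_eq_iSup]; exact ·)
  have htop := (Submodule.orthogonal_eq_bot_iff).1
    (ContinuousLinearMap.orthogonalComplement_iSup_eigenspaces_eq_bot hT hT')
  rw [htop] at hfd
  exact hH (Module.Finite.equiv Submodule.topEquiv)

/-- Unit eigenvectors for distinct eigenvalues are orthogonal, so their images have squared distance
λ² + λ'² ≥ ε². Infinitely many of them would have no convergent subsequence of images. -/
theorem finite_setOf_hasEigenvalue_ge (hT : IsCompactOperator T) (hT' : T.IsSymmetric) {ε : ℝ}
    (hε : 0 < ε) : {μ | HasEigenvalue (T : Module.End ℝ H) μ ∧ ε ≤ μ}.Finite := by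
  by_contra hinf
  let f := Set.Infinite.natEmbedding _ hinf
  have hv : ∀ n, ∃ x : H, ‖x‖ = 1 ∧ T x = (f n : ℝ) • x := fun n => by
    obtain ⟨x, hx⟩ := (f n).2.1.exists_hasEigenvector
    have hn : ‖x‖ ≠ 0 := norm_ne_zero_iff.2 hx.2
    have h1 : T x = (f n : ℝ) • x := hx.apply_eq_smul
    refine ⟨‖x‖⁻¹ • x, ?_, ?_⟩
    · rw [norm_smul, norm_inv, norm_norm, inv_mul_cancel₀ hn]
    · rw [map_smul, h1, smul_comm]
  choose x hx1 hxT using hv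
  have hfar : ∀ i j, i ≠ j → ε ≤ ‖T (x i) - T (x j)‖ := by
    intro i j hij
    have hne : (f i : ℝ) ≠ f j := fun h => hij (f.injective (Subtype.ext h))
    have horth : inner ℝ (x i) (x j) = 0 := by
      have h1 : inner ℝ (T (x i)) (x j) = inner ℝ (x i) (T (x j)) := hT' (x i) (x j)
      rw [hxT, hxT, real_inner_smul_left, real_inner_smul_right] at h1
      exact (mul_eq_zero.1 (show ((f i : ℝ) - f j) * inner ℝ (x i) (x j) = 0 by
        linear_combination h1)).resolve_left (sub_ne_zero.2 hne)
    refine le_of_sq_le_sq ?_ (norm_nonneg _)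
    rw [@norm_sub_sq ℝ, hxT, hxT, norm_smul, norm_smul, hx1, hx1, real_inner_smul_left,
      real_inner_smul_right, horth]
    simp only [mul_one, mul_zero, sub_zero, map_zero, Real.norm_eq_abs, sq_abs]
    nlinarith [(f i).2.2, sq_nonneg (f j : ℝ)]
  obtain ⟨K, hK, hK'⟩ := hT.image_closedBall_subset_compact (1 : ℝ)
  obtain ⟨y, -, ψ, hψ, hlim⟩ := hK.tendsto_subseq (x := fun n => T (x n))
    fun n => hK' ⟨x n, by simp [hx1], rfl⟩
  obtain ⟨N, hN⟩ := Metric.cauchySeq_iff'.1 hlim.cauchySeq ε hε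
  have h1 := hN (N + 1) (Nat.le_succ N)
  rw [dist_eq_norm] at h1
  exact absurd (hfar _ _ (hψ.injective.ne (Nat.succ_ne_self N))) (not_le.2 h1)

end CompactSymmetric

theorem not_finiteDimensional_ellTwo : ¬ FiniteDimensional ℝ (lp (fun _ : ℕ => ℝ) 2) := by
  intro h
  have hv : LinearIndependent ℝ (fun i : ℕ => lp.single (E := fun _ : ℕ => ℝ) 2 i (1 : ℝ)) := by
    refine (show Orthonormal ℝ _ from ?_).linearIndependent
    rw [orthonormal_iff_ite]
    intro i j
    rw [lp.inner_single_left, lp.single_apply]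
    by_cases hij : i = j
    · subst hij; simp
    · simp [hij]
  exact not_finite_iff_infinite.2 (inferInstance : Infinite ℕ) hv.finite

/-! ### The symmetrized operator on ℓ² and its spectrum -/

/-- The square roots of the diagonal weights. -/
noncomputable def rootWeight (n : ℕ) : ℝ := √(diagWeight n)

theorem rootWeight_pos (n : ℕ) : 0 < rootWeight n := Real.sqrt_pos.2 (diagWeight_pos n)

theorem rootWeight_sq (n : ℕ) : rootWeight n ^ 2 = diagWeight n :=
  Real.sq_sqrt (diagWeight_pos n).le

theorem le_rootWeight (n : ℕ) : (n : ℝ) + 1 ≤ rootWeight n :=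
  Real.le_sqrt_of_sq_le (sq_le_diagWeight n)

/-- The action of the symmetrized operator `D^{-1/2} T D^{-1/2}`, where `𝒜(μ) = μ D - T`. -/
noncomputable def symSeq (w : ℕ → ℝ) : ℕ → ℝ :=
  triSeq (fun n => -coeffA 0 (n + 1) / diagWeight n)
    (fun n => -coeffB (n + 1) / (rootWeight n * rootWeight (n - 1)))
    (fun n => -coeffC (n + 1) / (rootWeight n * rootWeight (n + 1))) w

theorem symSeq_rootWeight_mul (v : ℕ → ℝ) (n : ℕ) :
    rootWeight n * symSeq (fun n => rootWeight n * v n) n = -seqOp 0 v n := by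
  have hp := rootWeight_pos
  have hs := rootWeight_sq
  have h1 : ∀ m : ℕ, rootWeight m * (-coeffA 0 (m + 1) / diagWeight m * (rootWeight m * v m))
      = -coeffA 0 (m + 1) * v m := fun m => by
    rw [← hs]
    have := (hp m).ne'
    field_simp
  have h2 : ∀ (c : ℝ) (m k : ℕ), rootWeight m * (-c / (rootWeight m * rootWeight k) *
      (rootWeight k * v k)) = -c * v k := fun c m k => by
    have := (hp m).ne'
    have := (hp k).ne'
    field_simp
  cases n with
  | zero =>
    simp only [symSeq, triSeq, seqOp, mul_add, h1, h2]
    simp only [zero_add]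
    ring
  | succ n =>
    simp only [symSeq, triSeq, seqOp, mul_add, h1, h2, Nat.add_sub_cancel]
    ring

theorem symSeq_eq_iff {μ : ℝ} {v : ℕ → ℝ} :
    symSeq (fun n => rootWeight n * v n) = (fun n => μ * (rootWeight n * v n)) ↔
      seqOp μ v = 0 := by
  have key : ∀ n, seqOp μ v n = rootWeight n *
      (μ * (rootWeight n * v n) - symSeq (fun n => rootWeight n * v n) n) := fun n => by
    rw [mul_sub, symSeq_rootWeight_mul, seqOp_eq, ← rootWeight_sq]
    ring
  constructor
  · intro h
    funext n
    rw [key, h, sub_self, mul_zero, Pi.zero_apply]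
  · intro h
    funext n
    have h1 := key n
    rw [h, Pi.zero_apply, eq_comm, mul_eq_zero, or_iff_right (rootWeight_pos n).ne',
      sub_eq_zero] at h1
    exact h1.symm

theorem abs_symSeq_offdiag_le (n : ℕ) {c : ℝ} (hc : |c| ≤ 2 * ((n : ℝ) + 1)) (m : ℕ)
    (hm : (n : ℝ) + 1 ≤ 2 * (m + 1)) :
    |-c / (rootWeight n * rootWeight m)| ≤ 4 * ((n : ℝ) + 1) ^ (-1 : ℝ) := by
  have h1 := le_rootWeight n
  have h2 := le_rootWeight m
  have hn : (0 : ℝ) < (n : ℝ) + 1 := by positivity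
  have h3 : ((n : ℝ) + 1) * ((m : ℝ) + 1) ≤ rootWeight n * rootWeight m :=
    mul_le_mul h1 h2 (by positivity) (rootWeight_pos n).le
  have h4 : 0 < rootWeight n * rootWeight m := mul_pos (rootWeight_pos n) (rootWeight_pos m)
  rw [abs_div, abs_neg, abs_of_pos h4, Real.rpow_neg_one, ← div_eq_mul_inv, div_le_div_iff₀ h4 hn]
  have h5 := mul_le_mul_of_nonneg_right hc hn.le
  have h6 := mul_le_mul_of_nonneg_left hm hn.le
  nlinarith

theorem abs_symSeq_diag_le (n : ℕ) :
    |-coeffA 0 (n + 1) / diagWeight n| ≤ 4 * ((n : ℝ) + 1) ^ (-1 : ℝ) := by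
  have h := abs_symSeq_offdiag_le n (abs_coeffA_zero_le_linear n) n (by
    have hn : (0 : ℝ) ≤ n := Nat.cast_nonneg n
    linarith)
  rwa [← sq, rootWeight_sq] at h

theorem abs_symSeq_upper_le (n : ℕ) :
    |-coeffC (n + 1) / (rootWeight n * rootWeight (n + 1))| ≤ 4 * ((n : ℝ) + 1) ^ (-1 : ℝ) :=
  abs_symSeq_offdiag_le n (abs_coeffC_le_linear n) _ (by
    have hn : (0 : ℝ) ≤ n := Nat.cast_nonneg n
    push_cast
    linarith)

theorem abs_symSeq_lower_le (n : ℕ) :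
    |-coeffB (n + 1) / (rootWeight n * rootWeight (n - 1))| ≤ 4 * ((n : ℝ) + 1) ^ (-1 : ℝ) :=
  abs_symSeq_offdiag_le n (abs_coeffB_le_linear n) _ (by
    cases n with
    | zero => norm_num
    | succ n =>
      have hn : (0 : ℝ) ≤ n := Nat.cast_nonneg n
      rw [Nat.add_sub_cancel]
      push_cast
      linarith)

theorem ellTwo_mem_hSubmodule (u : lp (fun _ : ℕ => ℝ) 2) : (u : ℕ → ℝ) ∈ hSubmodule 0 := by
  have := (memℓp_gen_iff (p := 2) (by norm_num)).1 (lp.memℓp u)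
  change Summable _
  simpa using this

theorem ellTwo_of_mem_hSubmodule {v : ℕ → ℝ} (hv : v ∈ hSubmodule 0) :
    ∃ u : lp (fun _ : ℕ => ℝ) 2, (u : ℕ → ℝ) = v :=
  ⟨WeightedSeq.toLpEquiv 0 (WeightedSeq.mk v hv), funext fun n => by
    rw [WeightedSeq.toLpEquiv_apply]; simp⟩

/-- The entries are of order 1/n, which is compact on h^0, identified here with ℓ². Symmetry follows
from the equality of the off-diagonal entries, the boundary term tending to 0. -/
theorem exists_symSeq_operator : ∃ K : lp (fun _ : ℕ => ℝ) 2 →L[ℝ] lp (fun _ : ℕ => ℝ) 2,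
    (∀ u, (K u : ℕ → ℝ) = symSeq u) ∧ IsCompactOperator K ∧ K.IsSymmetric := by
  obtain ⟨L, hL, hcomp⟩ := exists_compact_triSeq (α := 0) (β := 0) abs_symSeq_diag_le
    abs_symSeq_lower_le abs_symSeq_upper_le (by norm_num)
  let e := (WeightedSeq.toLpEquiv 0).toContinuousLinearEquiv
  let K : lp (fun _ : ℕ => ℝ) 2 →L[ℝ] lp (fun _ : ℕ => ℝ) 2 :=
    (e : WeightedSeq 0 →L[ℝ] lp (fun _ : ℕ => ℝ) 2) ∘L L ∘L
      (e.symm : lp (fun _ : ℕ => ℝ) 2 →L[ℝ] WeightedSeq 0)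
  have hseq : ∀ v : WeightedSeq 0, (e v : ℕ → ℝ) = v := fun v => funext fun n => by
    refine (WeightedSeq.toLpEquiv_apply 0 v n).trans ?_
    simp
  have hK : ∀ u, (K u : ℕ → ℝ) = symSeq u := by
    intro u
    have h1 : WeightedSeq.toSeq 0 (e.symm u) = (u : ℕ → ℝ) := by
      rw [← hseq, e.apply_symm_apply]
    refine (hseq (L (e.symm u))).trans (funext fun n => ?_)
    rw [hL, h1]
    rfl
  have hKc : IsCompactOperator K :=
    (hcomp.comp_clm (e.symm : lp (fun _ : ℕ => ℝ) 2 →L[ℝ] WeightedSeq 0)).clm_comp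
      (e : WeightedSeq 0 →L[ℝ] lp (fun _ : ℕ => ℝ) 2)
  refine ⟨K, hK, hKc, fun x y => ?_⟩
  have hx := tendsto_zero_of_mem le_rfl (ellTwo_mem_hSubmodule x)
  have hy := tendsto_zero_of_mem le_rfl (ellTwo_mem_hSubmodule y)
  have h1 := summable_mul_of_mem (ellTwo_mem_hSubmodule x) (ellTwo_mem_hSubmodule (K y))
  have h2 := summable_mul_of_mem (ellTwo_mem_hSubmodule (K x)) (ellTwo_mem_hSubmodule y)
  change inner ℝ (K x) y = inner ℝ x (K y)
  rw [lp.inner_eq_tsum, lp.inner_eq_tsum]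
  simp only [RCLike.inner_apply, conj_trivial]
  simp only [hK] at h1 h2 ⊢
  have h := tsum_mul_triSeq (v := x) (w := y) (fun n => by
    rw [coeffB_eq_coeffC, Nat.add_sub_cancel, mul_comm (rootWeight (n + 1))]) ?_ h1 h2
  · exact (tsum_congr fun n => mul_comm _ _).trans (h.symm.trans (tsum_congr fun n => mul_comm _ _))
  · have hx1 := hx.comp (tendsto_add_atTop_nat 1)
    have hy1 := hy.comp (tendsto_add_atTop_nat 1)
    have hb := ((hx.mul hy1).sub (hx1.mul hy)).abs.const_mul 4
    simp only [mul_zero, sub_zero, abs_zero] at hb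
    refine squeeze_zero_norm (fun n => ?_) hb
    rw [norm_mul, Real.norm_eq_abs, Real.norm_eq_abs]
    refine mul_le_mul_of_nonneg_right ((abs_symSeq_upper_le n).trans ?_) (abs_nonneg _)
    rw [Real.rpow_neg_one]
    have : ((n : ℝ) + 1)⁻¹ ≤ 1 := inv_le_one_of_one_le₀ (by simp)
    linarith

theorem rootWeight_mul_mem {v : ℕ → ℝ} (hv : v ∈ hSubmodule 1) :
    (fun n => rootWeight n * v n) ∈ hSubmodule 0 := by
  have h : Summable fun n : ℕ => ((n : ℝ) + 1) ^ (2 * (1 : ℝ)) * v n ^ 2 := hv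
  refine Summable.of_nonneg_of_le (fun n => by positivity) (fun n => ?_) (h.mul_left 8)
  have hn : (0 : ℝ) ≤ n := Nat.cast_nonneg n
  rw [mul_pow, rootWeight_sq]
  simp only [mul_zero, Real.rpow_zero, one_mul, mul_one, Real.rpow_ofNat]
  rw [← mul_assoc]
  refine mul_le_mul_of_nonneg_right ?_ (sq_nonneg _)
  unfold diagWeight
  nlinarith

theorem exists_symSeq_eigenvector {α : ℝ} (hα : 0 ≤ α) {μ : ℝ} (h : (opA α μ).ker ≠ ⊥) :
    ∃ w ∈ hSubmodule 0, w ≠ 0 ∧ symSeq w = fun n => μ * w n := by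
  obtain ⟨v, hv, h0⟩ := Submodule.exists_mem_ne_zero_of_ne_bot h
  refine ⟨fun n => rootWeight n * v n,
    rootWeight_mul_mem (hSubmodule_antitone (by linarith) v.mem), fun hw => ?_,
    symSeq_eq_iff.2 (mem_ker_opA.1 hv)⟩
  exact (mul_ne_zero (rootWeight_pos 0).ne' (apply_zero_ne_zero_of_mem_ker hv h0)) (congrFun hw 0)

/-- Undoing the weight yields only an ℓ² solution. Decay already forces μ > 0, and then the
regularity bootstrap puts the solution in h^{α+2}. -/
theorem ker_opA_ne_bot_of_symSeq (α : ℝ) {μ : ℝ} {w : ℕ → ℝ} (hw : w ∈ hSubmodule 0)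
    (h0 : w ≠ 0) (h : symSeq w = fun n => μ * w n) : 0 < μ ∧ (opA α μ).ker ≠ ⊥ := by
  let v : ℕ → ℝ := fun n => (rootWeight n)⁻¹ * w n
  have hwv : (fun n => rootWeight n * v n) = w :=
    funext fun n => mul_inv_cancel_left₀ (rootWeight_pos n).ne' _
  have hv0 : v ≠ 0 := fun e => h0 (by
    rw [← hwv, e]
    funext n
    exact mul_zero _)
  have hv : seqOp μ v = 0 := symSeq_eq_iff.1 (by
    rw [hwv, h]
    funext n
    rw [congrFun hwv n])
  have hmem : v ∈ hSubmodule 0 := by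
    refine Summable.of_nonneg_of_le (fun n => by positivity) (fun n => ?_) hw
    refine mul_le_mul_of_nonneg_left ?_ (by positivity)
    rw [mul_pow]
    have h1 : (1 : ℝ) ≤ rootWeight n := le_trans (by simp) (le_rootWeight n)
    exact mul_le_of_le_one_left (sq_nonneg _)
      (pow_le_one₀ (inv_nonneg.2 (rootWeight_pos n).le) (inv_le_one_of_one_le₀ h1))
  have hμ : 0 < μ := by
    by_contra! hle
    exact hv0 (eq_zero_of_seqOp_eq_zero_of_nonpos hle hv (tendsto_zero_of_mem le_rfl hmem))
  refine ⟨hμ, fun hbot => hv0 ?_⟩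
  have hm := mem_hSubmodule_of_seqOp_eq_zero hμ.ne' hv hmem (α + 2)
  have h1 : WeightedSeq.mk v hm ∈ (opA α μ).ker := mem_ker_opA.2 hv
  rw [hbot, Submodule.mem_bot] at h1
  funext n
  exact (congrArg (fun x : WeightedSeq (α + 2) => x n) h1).trans (WeightedSeq.zero_apply n)

theorem exists_eigenvalue_sequence {α : ℝ} (hα : 0 ≤ α) : ∃ m : ℕ → ℝ, StrictAnti m ∧
    (∀ k, 0 < m k) ∧ Tendsto m atTop (𝓝 0) ∧ ∀ μ, (opA α μ).ker ≠ ⊥ ↔ ∃ k, m k = μ := by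
  obtain ⟨K, hK, hcomp, hsymm⟩ := exists_symSeq_operator
  have hiff : ∀ μ : ℝ, Module.End.HasEigenvalue (K : Module.End ℝ (lp (fun _ : ℕ => ℝ) 2)) μ ↔
      (opA α μ).ker ≠ ⊥ := by
    intro μ
    constructor
    · intro h
      obtain ⟨u, hu⟩ := h.exists_hasEigenvector
      have h1 : K u = μ • u := hu.apply_eq_smul
      refine (ker_opA_ne_bot_of_symSeq α (ellTwo_mem_hSubmodule u)
        (fun e => hu.2 (lp.ext e)) ?_).2
      rw [← hK, h1]
      rfl
    · intro h
      obtain ⟨w, hw, h0, hs⟩ := exists_symSeq_eigenvector hα h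
      obtain ⟨u, rfl⟩ := ellTwo_of_mem_hSubmodule hw
      refine Module.End.hasEigenvalue_of_hasEigenvector (x := u)
        ⟨Module.End.mem_eigenspace_iff.2 (lp.ext ?_), fun e => h0 (by rw [e]; rfl)⟩
      exact (hK u).trans hs
  have hpos : ∀ μ, (opA α μ).ker ≠ ⊥ → 0 < μ := fun μ h => by
    obtain ⟨w, hw, h0, hs⟩ := exists_symSeq_eigenvector hα h
    exact (ker_opA_ne_bot_of_symSeq α hw h0 hs).1
  have hinf := infinite_setOf_hasEigenvalue hcomp hsymm
    (fun h => lt_irrefl _ (hpos 0 ((hiff 0).1 h))) not_finiteDimensional_ellTwo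
  obtain ⟨m, hm, hr, hlim⟩ := exists_strictAnti_range_eq
    (fun μ hμ => hpos μ ((hiff μ).1 hμ)) hinf
    (fun ε hε => finite_setOf_hasEigenvalue_ge hcomp hsymm hε)
  have hmem : ∀ μ, (opA α μ).ker ≠ ⊥ ↔ ∃ k, m k = μ := fun μ =>
    (hiff μ).symm.trans (Set.ext_iff.1 hr μ).symm
  exact ⟨m, hm, fun k => hpos _ ((hmem _).2 ⟨k, rfl⟩), hlim, hmem⟩

/-! ### The Gershgorin bound for the largest eigenvalue -/

theorem exists_forall_abs_le {w : ℕ → ℝ} (hw : Tendsto w atTop (𝓝 0)) (h0 : w ≠ 0) :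
    ∃ p, w p ≠ 0 ∧ ∀ n, |w n| ≤ |w p| := by
  obtain ⟨q, hq⟩ := Function.ne_iff.1 h0
  have hq' : 0 < |w q| := abs_pos.2 hq
  have hlim := hw.abs
  rw [abs_zero] at hlim
  obtain ⟨N, hN⟩ := eventually_atTop.1 (hlim.eventually_le_const hq')
  obtain ⟨p, -, hp⟩ := (Finset.range (N + q + 1)).exists_max_image (fun n => |w n|) ⟨q, by simp⟩
  have hqp := hp q (by simp)
  refine ⟨p, abs_pos.1 (hq'.trans_le hqp), fun n => ?_⟩
  by_cases hn : n < N + q + 1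
  · exact hp n (Finset.mem_range.2 hn)
  · exact (hN n (by omega)).trans hqp

/-- The moduli of the off-diagonal entries of the symmetrized operator. -/
noncomputable def offdiag (n : ℕ) : ℝ := coeffC (n + 1) / (rootWeight n * rootWeight (n + 1))

theorem offdiag_pos (n : ℕ) : 0 < offdiag n :=
  div_pos (coeffC_pos n) (mul_pos (rootWeight_pos n) (rootWeight_pos _))

theorem offdiag_sq (n : ℕ) : offdiag n ^ 2 = (2 * n + 4) * (2 * n + 1) * (2 * n + 3) /
    ((4 * n + 5) * (4 * n + 9) * (2 * n + 6) * (4 * n + 7) ^ 2) := by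
  unfold offdiag
  rw [coeffC_eq, div_div, div_pow, mul_pow, mul_pow, mul_pow, normFactor_sq, normFactor_sq,
    rootWeight_sq, rootWeight_sq]
  unfold bond diagWeight
  rw [div_pow, div_div, div_eq_div_iff (by positivity) (by positivity)]
  push_cast
  ring

theorem offdiag_zero : offdiag 0 = √2 / (21 * √5) := by
  rw [← sq_eq_sq₀ (offdiag_pos 0).le (by positivity), offdiag_sq, div_pow, mul_pow,
    Real.sq_sqrt (by norm_num), Real.sq_sqrt (by norm_num)]
  norm_num

theorem offdiag_one : offdiag 1 = √5 / (22 * √13) := by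
  rw [← sq_eq_sq₀ (offdiag_pos 1).le (by positivity), offdiag_sq, div_pow, mul_pow,
    Real.sq_sqrt (by norm_num), Real.sq_sqrt (by norm_num)]
  norm_num

theorem offdiag_succ_le (n : ℕ) : offdiag (n + 1) ≤ 3 / 100 := by
  have hn : (0 : ℝ) ≤ n := Nat.cast_nonneg n
  refine le_of_sq_le_sq ?_ (by norm_num)
  rw [offdiag_sq, div_le_iff₀ (by positivity)]
  push_cast
  ring_nf
  nlinarith [pow_nonneg hn 2, pow_nonneg hn 3, pow_nonneg hn 4, pow_nonneg hn 5]

/-- The diagonal entries of the symmetrized operator. -/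
noncomputable def symDiag (n : ℕ) : ℝ := -coeffA 0 (n + 1) / diagWeight n

theorem symDiag_zero : symDiag 0 = 11 / 210 := by
  norm_num [symDiag, coeffA, diagWeight]

theorem symDiag_one : symDiag 1 = 127 / 2079 := by
  norm_num [symDiag, coeffA, diagWeight]

theorem symDiag_add_two (n : ℕ) : 0 ≤ symDiag (n + 2) ∧ symDiag (n + 2) ≤ 55 / 1000 := by
  have hn : (0 : ℝ) ≤ n := Nat.cast_nonneg n
  have hd := diagWeight_pos (n + 2)
  have h : symDiag (n + 2) = (bond (n + 1) + bond (n + 2)) / ((4 * ((n + 1 : ℕ) : ℝ) + 9) *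
      diagWeight (n + 2)) := by
    unfold symDiag
    rw [coeffA_zero_add_two (n + 1), neg_div (4 * ((n + 1 : ℕ) : ℝ) + 9), neg_neg, div_div]
  rw [h]
  refine ⟨div_nonneg (add_pos (bond_pos _) (bond_pos _)).le (by positivity), ?_⟩
  rw [div_le_iff₀ (by positivity)]
  unfold bond diagWeight
  push_cast
  rw [div_add_div _ _ (by positivity) (by positivity), div_le_iff₀ (by positivity)]
  ring_nf
  nlinarith [pow_nonneg hn 2, pow_nonneg hn 3, pow_nonneg hn 4, pow_nonneg hn 5]

/-- Rationalizing leaves √10/105 + √65/286 + 127/2079, so brackets for two single roots suffice. -/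
theorem gershgorin_value_approx :
    |√2 / (21 * √5) + √5 / (22 * √13) + 127 / 2079 - 0.119394| < 5e-7 := by
  have h1 : √2 / (21 * √5) = √10 / 105 := by
    rw [← sq_eq_sq₀ (by positivity) (by positivity), div_pow, div_pow, mul_pow,
      Real.sq_sqrt (by norm_num), Real.sq_sqrt (by norm_num), Real.sq_sqrt (by norm_num)]
    norm_num
  have h2 : √5 / (22 * √13) = √65 / 286 := by
    rw [← sq_eq_sq₀ (by positivity) (by positivity), div_pow, div_pow, mul_pow,
      Real.sq_sqrt (by norm_num), Real.sq_sqrt (by norm_num), Real.sq_sqrt (by norm_num)]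
    norm_num
  have a1 : 3.162277 < √10 := Real.lt_sqrt_of_sq_lt (by norm_num)
  have a2 : √10 < 3.162278 := (Real.sqrt_lt' (by norm_num)).2 (by norm_num)
  have b1 : 8.062257 < √65 := Real.lt_sqrt_of_sq_lt (by norm_num)
  have b2 : √65 < 8.062258 := (Real.sqrt_lt' (by norm_num)).2 (by norm_num)
  rw [h1, h2, abs_lt]
  constructor <;> norm_num at a1 a2 b1 b2 ⊢ <;> linarith

theorem symSeq_zero (w : ℕ → ℝ) : symSeq w 0 = symDiag 0 * w 0 - offdiag 0 * w 1 := by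
  simp only [symSeq, triSeq, symDiag, offdiag]
  ring

theorem symSeq_succ (w : ℕ → ℝ) (n : ℕ) : symSeq w (n + 1) =
    symDiag (n + 1) * w (n + 1) - offdiag n * w n - offdiag (n + 1) * w (n + 2) := by
  simp only [symSeq, triSeq, symDiag, offdiag, coeffB_eq_coeffC, Nat.add_sub_cancel,
    mul_comm (rootWeight (n + 1)) (rootWeight n)]
  ring

/-- The row-sum bound for the eigenvalues. -/
theorem eigenvalue_le {μ : ℝ} {w : ℕ → ℝ} (hμ : 0 < μ) (hw : w ∈ hSubmodule 0) (h0 : w ≠ 0)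
    (h : symSeq w = fun n => μ * w n) :
    μ ≤ √2 / (21 * √5) + √5 / (22 * √13) + 127 / 2079 := by
  have hval := (abs_lt.1 gershgorin_value_approx).1
  rw [← offdiag_zero, ← offdiag_one] at hval ⊢
  -- The eigenvector tends to 0, so its modulus attains a positive maximum, and row p of the
  -- eigenvalue equation bounds μ by that row's sum.
  obtain ⟨p, hp0, hp⟩ := exists_forall_abs_le (tendsto_zero_of_mem le_rfl hw) h0
  have hpos : 0 < |w p| := abs_pos.2 hp0
  suffices hrow : |symSeq w p| ≤ (offdiag 0 + offdiag 1 + 127 / 2079) * |w p| by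
    rw [h, abs_mul, abs_of_pos hμ] at hrow
    exact le_of_mul_le_mul_right hrow hpos
  have ho : ∀ n m, |offdiag n * w m| ≤ offdiag n * |w p| := fun n m => by
    rw [abs_mul, abs_of_pos (offdiag_pos n)]
    exact mul_le_mul_of_nonneg_left (hp m) (offdiag_pos n).le
  have hp1 := offdiag_pos 1
  -- The row k = 2 gives exactly the claimed bound. Row k = 1 has a smaller diagonal entry and a
  -- single neighbour, and later rows sum to at most 0.055 + 0.03 + 0.03 = 0.115.
  rcases p with _ | _ | n
  · rw [symSeq_zero]
    refine (abs_sub _ _).trans ((add_le_add_right (ho _ _) _).trans ?_)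
    rw [abs_mul, symDiag_zero, abs_of_pos (by norm_num : (0 : ℝ) < 11 / 210), ← add_mul]
    exact mul_le_mul_of_nonneg_right (by linarith) hpos.le
  · rw [symSeq_succ]
    refine (abs_sub _ _).trans ((add_le_add ((abs_sub _ _).trans
      (add_le_add_right (ho _ _) _)) (ho _ _)).trans ?_)
    rw [abs_mul, zero_add, symDiag_one, abs_of_pos (by norm_num : (0 : ℝ) < 127 / 2079),
      ← add_mul, ← add_mul]
    exact mul_le_mul_of_nonneg_right (by linarith) hpos.le
  · rw [symSeq_succ]
    refine (abs_sub _ _).trans ((add_le_add ((abs_sub _ _).trans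
      (add_le_add_right (ho _ _) _)) (ho _ _)).trans ?_)
    have h1 := symDiag_add_two n
    rw [abs_mul, abs_of_nonneg h1.1, ← add_mul, ← add_mul]
    refine mul_le_mul_of_nonneg_right ?_ hpos.le
    have h2 := offdiag_succ_le n
    have h3 := offdiag_succ_le (n + 1)
    norm_num at hval
    linarith [h1.2]

theorem mainTheorem4 (α : ℝ) (hα : 0 ≤ α) :
    (∀ μ : ℝ, μ ≠ 0 → IsEllTwoSymmetric (opA α μ) ∧ IsFredholmOfIndexZero (opA α μ)) ∧
    (∀ μ : ℝ, 0 < μ →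
      Module.rank ℝ (opA α μ).ker ≤ 1 ∧
      ∀ v ∈ (opA α μ).ker, ∀ β : ℝ, 0 ≤ β → WeightedSeq.toSeq (α + 2) v ∈ hSubmodule β) ∧
    (∀ μ : ℝ, μ ≤ 0 → (opA α μ).ker = ⊥) ∧
    ∃ m : ℕ → ℝ,
      StrictAnti m ∧ (∀ k, 0 < m k) ∧ Tendsto m atTop (𝓝 0) ∧
      (∀ k, Module.finrank ℝ (opA α (m k)).ker = 1) ∧
      (∀ μ : ℝ, μ ≠ 0 → (∀ k, μ ≠ m k) → (opA α μ).IsInvertible) ∧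
      (m 0 ≤ √2 / (21 * √5) + √5 / (22 * √13) + 127 / 2079 ∧
        |√2 / (21 * √5) + √5 / (22 * √13) + 127 / 2079 - 0.119394| < 5e-7) ∧
      (∀ k, ∃ A' : WeightedSeq (α + 2) →L[ℝ] WeightedSeq α,
        HasDerivAt (fun μ : ℝ => opA α μ) A' (m k) ∧
        ∀ v ∈ (opA α (m k)).ker, v ≠ 0 → A' v ∉ (opA α (m k)).range) := by
  obtain ⟨m, hanti, hpos, hlim, hmem⟩ := exists_eigenvalue_sequence hα
  refine ⟨fun μ hμ => ⟨isEllTwoSymmetric_opA hα μ, isFredholmOfIndexZero_opA hα hμ⟩,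
    fun μ hμ => ⟨rank_ker_opA_le α μ, fun v hv β _ => ?_⟩,
    fun μ hμ => ker_opA_eq_bot_of_nonpos hα hμ, m, hanti, hpos, hlim,
    fun k => finrank_ker_opA ((hmem _).2 ⟨k, rfl⟩), fun μ hμ hne => ?_,
    ⟨?_, gershgorin_value_approx⟩,
    fun k => ⟨diagOp α, hasDerivAt_opA α _, fun v hv h0 => diagOp_notMem_range hα hv h0⟩⟩
  · exact mem_hSubmodule_of_seqOp_eq_zero hμ.ne' (mem_ker_opA.1 hv)
      (hSubmodule_antitone (by linarith) v.mem) β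
  · refine isInvertible_opA hμ ?_
    by_contra h
    obtain ⟨k, hk⟩ := (hmem μ).1 h
    exact hne k hk.symm
  · obtain ⟨w, hw, h0, hs⟩ := exists_symSeq_eigenvector hα ((hmem (m 0)).2 ⟨0, rfl⟩)
    exact eigenvalue_le (hpos 0) hw h0 hs
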